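/- Let $n\ge 1$, $\alpha\in(0,1)$, and write $\mathrm{VaR}_\beta[Z]=\inf\{m:\mathbb P(Z+m<0)\le\beta\}$, $\mathrm{ES}_\alpha[Z]=\alpha^{-1}\int_0^\alpha \mathrm{VaR}_\beta[Z]\,d\beta$. **Claims.** Let $L=(L_1,\dots,L_n)$ be a random vector with $\mathbb E[L]=0$ and a bounded, strictly positive, continuous density $f_L$ such that, for some $\delta>0$ and some $g:\mathbb R^n\to\mathbb R$ with $\int(1+|\ell|^2)g(\ell)\,d\ell<\infty$, one has $f_L(\ell+s\mathbf 1)\le g(\ell)$ for all $\ell\in\mathbb R^n$, $|s|\le\delta$, where $\mathbf 1=(1,\dots,1)'$. (This holds e.g. if $f_L$ is $C^1$ and $f_L$, $\nabla f_L$ are integrable against $1+|\ell|^2$.) **Assets.** An asset vector is a random vector $X=(X_1,\dots,X_n)$, a.s. strictly positive, independent of $L$, with $X_i$, $X_i^{-1}$ integrable and $\mathbb E[X_i]=1$. Let $\Sigma=\Sigma_X$ be its covariance matrix, $\sigma_N(X)=\max_i \mathrm{Var}[X_i]^{1/2}$ and $\sigma_{lN}(X)=\max_i\mathrm{Var}[\log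 X_i]^{1/2}$ its normal and log-normal volatility. The surplus is $S(\varphi)=S_X(\varphi)=\langle X-\mathbf 1,\varphi\rangle-\langle X,L\rangle$, $\varphi\in\mathbb R^n$. **Notation.** $q=\mathrm{VaR}_\alpha[-\langle\mathbf 1,L\rangle]$; $f$ is the derivative of the distribution function of $\langle \mathbf 1,L\rangle$; $\mathbf K(y)=\mathbb E[L\,1_{\langle\mathbf 1,L\rangle>y}]$; and $K[Z](y)=\mathbb E[\langle Z,\Sigma Z\rangle\,1_{\langle\mathbf 1,L\rangle>y}]$ for $Z=L$ and $Z=\varphi-L$. Then $f$ is a continuous, strictly positive density of $\langle\mathbf 1,L\rangle$, $\mathbb P(\langle\mathbf 1,L\rangle\le q)=1-\alpha$, and $\mathbf K$ and, for every square integrable asset vector $X$ and every $\varphi\in\mathbb R^n$, $K[L]$ and $K[\varphi-L]$ are differentiable at $q$. Put $$E_X(\varphi):=\mathrm{ES}_\alpha[-\langle\mathbf 1,L\rangle]-\tfrac1{2\alpha}K[\varphi-L]'(q).$$ a) For every $\varphi\in\mathbb R^n$, $$\mathrm{ES}_\alpha[S_X(\varphi)]=E_X(\varphi)+o(\sigma^2)\qquad(\sigma\to0),$$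 in each of the following situations: 1. $X=X_t$ runs through any family (indexed by a filtered set) of square integrable asset vectors with $\sigma=\sigma_t=\sigma_N(X_t)\to0$, or with $\sigma=\sigma_t=\sigma_{lN}(X_t)\to 0$, such that the family $(X_t-\mathbf 1)/\sigma_t$ is uniformly square integrable (uniformly integrable in $L^2$); 2. $X=1+\sigma Y$, $\sigma\downarrow0$, where $Y=(X^0-\mathbf 1)/\sigma_N(X^0)$ for a square integrable asset vector $X^0$ with $\sigma_N(X^0)>0$; 3. $X_i=e^{\sigma Y_i}/\mathbb E[e^{\sigma Y_i}]$, $\sigma\downarrow0$, where $Y_i=(\log X^0_i-\mathbb E[\log X^0_i])/\sigma_{lN}(X^0)$ for an asset vector $X^0$ with $\sigma_{lN}(X^0)>0$. Moreover, for every square integrable asset vector $X$ and every $\varphi\in\mathbb R^n$, $$E_X(\varphi)=\mathrm{ES}_\alpha[-\langle\mathbf 1,L\rangle]+\tfrac1{2\alpha}\Big\{\langle\varphi,\Sigma\varphi\rangle f(q)+2\langle\Sigma\varphi,\mathbf K'(q)\rangle-K[L]'(q)\Big\}.$$ b) If $X$ is a square integrable asset vector and $\Sigma$ is invertible, then $E_X$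 attains its minimum over $\mathbb R^n$ exactly at $\varphi^*=-f(q)^{-1}\,\mathbf K'(q)$. -/

import Mathlib

open MeasureTheory ProbabilityTheory Filter Topology Asymptotics
open scoped Matrix

noncomputable section

/-- Value-at-risk at level `α` of a position `Z`: the least capital `m` for which
`P(Z + m < 0) ≤ α`. -/
def VaR {Ω : Type*} [MeasurableSpace Ω] (P : Measure Ω) (α : ℝ) (Z : Ω → ℝ) : ℝ :=
  sInf {m : ℝ | P.real {ω | Z ω + m < 0} ≤ α}

/-- Expected shortfall `ES_α[Z] = α⁻¹ ∫₀^α VaR_β[Z] dβ`. -/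
def ES {Ω : Type*} [MeasurableSpace Ω] (P : Measure Ω) (α : ℝ) (Z : Ω → ℝ) : ℝ :=
  α⁻¹ * ∫ β in (0 : ℝ)..α, VaR P β Z

/-- The surplus `S(φ) = ⟨X - 1, φ⟩ - ⟨X, L⟩`. -/
def surplus {Ω : Type*} {n : ℕ} (X L : Ω → Fin n → ℝ) (φ : Fin n → ℝ) (ω : Ω) : ℝ :=
  (X ω - 1) ⬝ᵥ φ - X ω ⬝ᵥ L ω

/-- The covariance matrix `Σ` of a random vector. -/
def covMatrix {Ω : Type*} [MeasurableSpace Ω] {n : ℕ} (P : Measure Ω) (X : Ω → Fin n → ℝ) :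
    Matrix (Fin n) (Fin n) ℝ :=
  Matrix.of fun i j => covariance (fun ω => X ω i) (fun ω => X ω j) P

/-- Normal volatility `σ_N = max_i Var[X_i]^{1/2}`. -/
def normalVol {Ω : Type*} [MeasurableSpace Ω] {n : ℕ} (P : Measure Ω) (X : Ω → Fin n → ℝ) : ℝ :=
  ⨆ i, √(variance (fun ω => X ω i) P)

/-- Log-normal volatility `σ_lN = max_i Var[log X_i]^{1/2}`. -/
def logVol {Ω : Type*} [MeasurableSpace Ω] {n : ℕ} (P : Measure Ω) (X : Ω → Fin n → ℝ) : ℝ :=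
  ⨆ i, √(variance (fun ω => Real.log (X ω i)) P)

/-- The standing assumptions on the vector `X` of tradeable assets: strictly positive, independent
of the claim sizes `L`, with `X_i` and `1 / X_i` integrable and `E[X_i] = 1`. -/
structure IsAssetVector {Ω : Type*} [MeasurableSpace Ω] {n : ℕ} (P : Measure Ω)
    (L X : Ω → Fin n → ℝ) : Prop where
  measurable : Measurable X
  pos : ∀ i, ∀ᵐ ω ∂P, 0 < X ω i
  indep : IndepFun X L P
  integrable : ∀ i, Integrable (fun ω => X ω i) P
  integrable_inv : ∀ i, Integrable (fun ω => (X ω i)⁻¹) P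
  mean_one : ∀ i, ∫ ω, X ω i ∂P = 1

/-- The distribution function of `⟨1, L⟩`. -/
def aggCdf {Ω : Type*} [MeasurableSpace Ω] {n : ℕ} (P : Measure Ω) (L : Ω → Fin n → ℝ)
    (y : ℝ) : ℝ :=
  P.real {ω | 1 ⬝ᵥ L ω ≤ y}

/-- The density of `⟨1, L⟩`, as the derivative of its distribution function. -/
def aggDensity {Ω : Type*} [MeasurableSpace Ω] {n : ℕ} (P : Measure Ω) (L : Ω → Fin n → ℝ) :
    ℝ → ℝ :=
  deriv (aggCdf P L)

/-- The quantile `q = VaR_α[-⟨1, L⟩]`. -/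
def aggQuantile {Ω : Type*} [MeasurableSpace Ω] {n : ℕ} (P : Measure Ω) (L : Ω → Fin n → ℝ)
    (α : ℝ) : ℝ :=
  VaR P α fun ω => -(1 ⬝ᵥ L ω)

/-- The vector-valued function `K(y) = E[L · 1_{⟨1, L⟩ > y}]`. -/
def KVec {Ω : Type*} [MeasurableSpace Ω] {n : ℕ} (P : Measure Ω) (L : Ω → Fin n → ℝ) (y : ℝ) :
    Fin n → ℝ :=
  ∫ ω, {ω | y < 1 ⬝ᵥ L ω}.indicator L ω ∂P

/-- The scalar function `K[Z](y) = E[⟨Z, Σ Z⟩ · 1_{⟨1, L⟩ > y}]`, with `Σ` the covariance matrix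
of `X`. -/
def KQuad {Ω : Type*} [MeasurableSpace Ω] {n : ℕ} (P : Measure Ω) (L X Z : Ω → Fin n → ℝ)
    (y : ℝ) : ℝ :=
  ∫ ω, {ω | y < 1 ⬝ᵥ L ω}.indicator (fun ω => Z ω ⬝ᵥ covMatrix P X *ᵥ Z ω) ω ∂P

/-- The second order expansion `ES_α[-⟨1, L⟩] - (1 / (2 α)) K[φ - L]'(q)` of `ES_α[S(φ)]`. -/
def esExpansion {Ω : Type*} [MeasurableSpace Ω] {n : ℕ} (P : Measure Ω) (α : ℝ)
    (L X : Ω → Fin n → ℝ) (φ : Fin n → ℝ) : ℝ :=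
  ES P α (fun ω => -(1 ⬝ᵥ L ω))
    - 1 / (2 * α) * deriv (KQuad P L X fun ω => φ - L ω) (aggQuantile P L α)

/-- The version `X_σ = 1 + σ Y` of `X` with normal volatility `σ`, where `Y = (X - 1) / σ_N(X)`. -/
def normalScaling {Ω : Type*} [MeasurableSpace Ω] {n : ℕ} (P : Measure Ω) (X : Ω → Fin n → ℝ)
    (σ : ℝ) (ω : Ω) (i : Fin n) : ℝ :=
  1 + σ * ((X ω i - 1) / normalVol P X)

/-- The centred and normalised logarithm `Y_i = (log X_i - E[log X_i]) / σ_lN(X)`. -/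
def normalizedLog {Ω : Type*} [MeasurableSpace Ω] {n : ℕ} (P : Measure Ω) (X : Ω → Fin n → ℝ)
    (i : Fin n) (ω : Ω) : ℝ :=
  (Real.log (X ω i) - ∫ ω', Real.log (X ω' i) ∂P) / logVol P X

/-- The version `X_σ = e^{σ Y} / E[e^{σ Y}]` (componentwise) of `X` with log-normal
volatility `σ`. -/
def logScaling {Ω : Type*} [MeasurableSpace Ω] {n : ℕ} (P : Measure Ω) (X : Ω → Fin n → ℝ)
    (σ : ℝ) (ω : Ω) (i : Fin n) : ℝ :=
  Real.exp (σ * normalizedLog P X i ω) / mgf (normalizedLog P X i) P σ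

end

/-! By Rockafellar and Uryasev, `α * ES[Z]` is the minimum over `m` of `α m + E[(-Z - m)⁺]`,
attained at `m = VaR_α[Z]`. The surplus is `S = -⟨1, L⟩ + ⟨X - 1, φ - L⟩`, so with `a = ⟨1, L⟩ - q`
and `w = m + ⟨X - 1, φ - L⟩` the functional at level `q + m` involves `(a - w)⁺ = a⁺ - w 1_{a > 0} +
kink a w`. Independence, `E[X] = 1` and `P(a > 0) = α` give `E[w 1_{a > 0}] = α m`, which cancels
the linear term. Hence `α * ES[S] - α * ES[-⟨1, L⟩]` is exactly the minimum over `m` of `E[kink a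
w]`, called `kinkRisk`.

As a function of `a`, the kink is a triangle of area `w² / 2` supported in `|a| ≤ |w|`, so for small
`w` it acts like `w² / 2` times a point mass at `a = 0`. Thus `kinkRisk` is about half the integral
of `w²` over the fibre `⟨1, L⟩ = q`, that is `(m² f(q) - K[φ - L]'(q)) / 2`: the cross term in `m`
vanishes because `X - 1` is centred. As `f(q) > 0` and `kinkRisk` is convex in `m`, its minimum
agrees with the contribution of `m = 0` up to `o(σ²)`.

The pointwise expansion for fixed `u = X - 1` is `isLittleO_kinkMean`. `exists_kinkMean_bound` makes
it uniform, at the price of a multiple of `|u|²` on `|u| > η`; uniform square integrability or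
domination makes the mean of that tail `o(σ²)`. The explicit formula expands a quadratic polynomial
under the fibre integral, and the minimiser comes from completing the square. -/

/-! ### Disintegration of Lebesgue measure along the component sum. -/

section Fibration

variable {n : ℕ}

/-- The point with component sum `y` on the line through `l` in direction `1`. -/
noncomputable def fiberPoint (y : ℝ) (l : Fin n → ℝ) : Fin n → ℝ := l + ((y - 1 ⬝ᵥ l) / n) • 1

/-- A measure transversal to the direction `1`: Lebesgue measure on a slab of unit width. -/
noncomputable def slabMeasure (n : ℕ) : Measure (Fin n → ℝ) :=
  volume.restrict {l | 1 ⬝ᵥ l ∈ Set.Ioc (0 : ℝ) 1}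

instance : SFinite (slabMeasure n) := by unfold slabMeasure; infer_instance

lemma continuous_one_dotProduct : Continuous fun l : Fin n → ℝ => 1 ⬝ᵥ l := by
  unfold dotProduct; fun_prop

lemma continuous_fiberPoint : Continuous fun z : ℝ × (Fin n → ℝ) => fiberPoint z.1 z.2 := by
  unfold fiberPoint dotProduct; fun_prop

lemma continuous_fiberPoint_left (l : Fin n → ℝ) : Continuous fun y => fiberPoint y l := by
  unfold fiberPoint; fun_prop

lemma continuous_fiberPoint_right (y : ℝ) : Continuous fun l : Fin n → ℝ => fiberPoint y l := by
  unfold fiberPoint dotProduct; fun_prop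

lemma one_dotProduct_add_smul_one (hn : 0 < n) (l : Fin n → ℝ) (y : ℝ) :
    1 ⬝ᵥ (l + (y / n) • (1 : Fin n → ℝ)) = 1 ⬝ᵥ l + y := by
  have : (n : ℝ) ≠ 0 := by positivity
  rw [dotProduct_add, dotProduct_smul]
  simp
  field_simp

lemma one_dotProduct_fiberPoint (hn : 0 < n) (y : ℝ) (l : Fin n → ℝ) :
    1 ⬝ᵥ fiberPoint y l = y := by
  rw [fiberPoint, one_dotProduct_add_smul_one hn]; ring

lemma fiberPoint_eq_add (y y' : ℝ) (l : Fin n → ℝ) :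
    fiberPoint y l = fiberPoint y' l + ((y - y') / n) • 1 := by
  rw [fiberPoint, fiberPoint, add_assoc, ← add_smul]
  congr 2; ring

/-- Shifting `y` by the component sum of `l` turns `fiberPoint y l` into `l + (y / n) • 1`. After
Tonelli, translating `l` moves the slab by `y`, and a given point lies in the moved slab for a set
of `y` of length one. -/
lemma lintegral_fiberPoint (hn : 0 < n) {F : (Fin n → ℝ) → ENNReal} (hF : Measurable F) :
    ∫⁻ z, F (fiberPoint z.1 z.2) ∂((volume : Measure ℝ).prod (slabMeasure n)) = ∫⁻ l, F l := by
  have hM : Measurable fun l : Fin n → ℝ => 1 ⬝ᵥ l := continuous_one_dotProduct.measurable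
  have hm1 : Measurable fun z : ℝ × (Fin n → ℝ) => F (z.2 + (z.1 / n) • 1) := by
    apply hF.comp; fun_prop
  set B : ℝ → ENNReal := (Set.Ioc (0 : ℝ) 1).indicator 1 with hB
  have hBm : Measurable B := measurable_one.indicator measurableSet_Ioc
  calc ∫⁻ z, F (fiberPoint z.1 z.2) ∂((volume : Measure ℝ).prod (slabMeasure n))
      = ∫⁻ l, (∫⁻ y, F (fiberPoint y l)) ∂slabMeasure n :=
        lintegral_prod_symm _ (hF.comp continuous_fiberPoint.measurable).aemeasurable
    _ = ∫⁻ l, (∫⁻ y : ℝ, F (l + (y / n) • 1)) ∂slabMeasure n := by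
        refine lintegral_congr fun l => ?_
        simp only [fiberPoint]
        exact lintegral_sub_right_eq_self (fun y : ℝ => F (l + (y / n) • 1)) ((1 : Fin n → ℝ) ⬝ᵥ l)
    _ = ∫⁻ y : ℝ, ∫⁻ l, F (l + (y / n) • 1) ∂slabMeasure n :=
        lintegral_lintegral_swap (hm1.comp measurable_swap).aemeasurable
    _ = ∫⁻ y : ℝ, ∫⁻ l : Fin n → ℝ, B ((1 : Fin n → ℝ) ⬝ᵥ l - y) * F l := by
        refine lintegral_congr fun y => ?_
        rw [slabMeasure, ← lintegral_indicator (by exact hM measurableSet_Ioc)]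
        rw [← lintegral_add_right_eq_self (fun l => B ((1 : Fin n → ℝ) ⬝ᵥ l - y) * F l) ((y / n) • 1)]
        refine lintegral_congr fun l => ?_
        rw [one_dotProduct_add_smul_one hn, add_sub_cancel_right, hB]
        by_cases h : 1 ⬝ᵥ l ∈ Set.Ioc (0 : ℝ) 1
        · rw [Set.indicator_of_mem (by exact h), Set.indicator_of_mem h]; simp
        · rw [Set.indicator_of_notMem (by exact h), Set.indicator_of_notMem h]; simp
    _ = ∫⁻ l : Fin n → ℝ, ∫⁻ y : ℝ, B ((1 : Fin n → ℝ) ⬝ᵥ l - y) * F l := by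
        refine lintegral_lintegral_swap (Measurable.aemeasurable ?_)
        exact (hBm.comp ((hM.comp measurable_snd).sub measurable_fst)).mul (hF.comp measurable_snd)
    _ = ∫⁻ l, F l := by
        refine lintegral_congr fun l => ?_
        have hm : Measurable fun y : ℝ => B ((1 : Fin n → ℝ) ⬝ᵥ l - y) :=
          hBm.comp (measurable_const.sub measurable_id)
        rw [lintegral_mul_const _ hm,
          lintegral_sub_left_eq_self B, hB, lintegral_indicator measurableSet_Ioc]
        simp

/-- Fibration of Lebesgue measure over the component sum. -/
lemma measurePreserving_fiberPoint (hn : 0 < n) :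
    MeasurePreserving (fun z : ℝ × (Fin n → ℝ) => fiberPoint z.1 z.2)
      ((volume : Measure ℝ).prod (slabMeasure n)) volume := by
  refine ⟨continuous_fiberPoint.measurable, Measure.ext fun s hs => ?_⟩
  rw [← lintegral_indicator_one hs, ← lintegral_indicator_one hs,
    lintegral_map (measurable_one.indicator hs) continuous_fiberPoint.measurable,
    lintegral_fiberPoint hn (measurable_one.indicator hs)]

lemma integral_eq_integral_fiberPoint (hn : 0 < n) {F : (Fin n → ℝ) → ℝ} (hF : Integrable F) :
    ∫ l, F l = ∫ y, ∫ l, F (fiberPoint y l) ∂slabMeasure n := by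
  have hp := measurePreserving_fiberPoint hn
  have h1 := hp.integrable_comp_of_integrable hF
  have h2 := integral_prod _ h1
  simp only [Function.comp_apply] at h2
  rw [← h2]
  conv_lhs => rw [← hp.map_eq]
  rw [integral_map hp.measurable.aemeasurable (by rw [hp.map_eq]; exact hF.1)]

lemma slabMeasure_ne_zero (hn : 0 < n) : slabMeasure n ≠ 0 := by
  intro h
  have hp := (measurePreserving_fiberPoint hn).map_eq
  rw [h, Measure.prod_zero, Measure.map_zero] at hp
  exact NeZero.ne (volume : Measure (Fin n → ℝ)) hp.symm

end Fibration

/-! ### Fibre integrals of a tame density. -/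

section Density

variable {n : ℕ}

/-- A positive continuous density whose suprema over short segments in direction `1` have a finite
second moment. -/
structure IsTameDensity (f : (Fin n → ℝ) → ℝ) : Prop where
  cont : Continuous f
  pos : ∀ l, 0 < f l
  dom : ∃ δ > 0, ∃ g : (Fin n → ℝ) → ℝ, Integrable (fun l => (1 + ‖l‖ ^ 2) * g l) ∧
    ∀ (l : Fin n → ℝ) (s : ℝ), |s| ≤ δ → f (l + s • 1) ≤ g l

/-- The density at `y` of the component sum under the measure with density `ψ f`. -/
noncomputable def fiberIntegral (f ψ : (Fin n → ℝ) → ℝ) (y : ℝ) : ℝ :=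
  ∫ l, ψ (fiberPoint y l) * f (fiberPoint y l) ∂slabMeasure n

/-- Continuous functions of at most quadratic growth. -/
def QuadGrowth (ψ : (Fin n → ℝ) → ℝ) : Prop :=
  Continuous ψ ∧ ∃ C, ∀ l, |ψ l| ≤ C * (1 + ‖l‖ ^ 2)

namespace IsTameDensity

variable {f : (Fin n → ℝ) → ℝ} (hf : IsTameDensity f)
include hf

lemma integrable_sq : Integrable fun l => (1 + ‖l‖ ^ 2) * f l := by
  obtain ⟨δ, hδ, g, hg, hfg⟩ := hf.dom
  have hc := hf.cont
  refine hg.mono' (by fun_prop) (Eventually.of_forall fun l => ?_)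
  have := hf.pos l
  rw [Real.norm_of_nonneg (by positivity)]
  gcongr
  simpa using hfg l 0 (by simpa using hδ.le)

lemma integrable_mul {ψ : (Fin n → ℝ) → ℝ} (hψ : AEStronglyMeasurable ψ)
    {C : ℝ} (hC : ∀ l, |ψ l| ≤ C * (1 + ‖l‖ ^ 2)) : Integrable fun l => ψ l * f l := by
  refine (hf.integrable_sq.const_mul C).mono' (hψ.mul hf.cont.aestronglyMeasurable)
    (Eventually.of_forall fun l => ?_)
  have := hf.pos l
  rw [Real.norm_eq_abs, abs_mul, abs_of_pos this, ← mul_assoc]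
  gcongr
  exact hC l

/-- Integrability of `g` on the whole space only controls almost every fibre. One good fibre `z`
near `y₀` suffices: nearby fibres are reached from it by shifts of at most `δ` in direction `1`.
Weight and density may sit on different fibres, as the kink estimate requires. -/
lemma exists_local_bound (hn : 0 < n) (y₀ : ℝ) : ∃ η > 0, ∃ G : (Fin n → ℝ) → ℝ,
    Integrable G (slabMeasure n) ∧ ∀ l y y', |y - y₀| ≤ η → |y' - y₀| ≤ η →
      (1 + ‖fiberPoint y' l‖ ^ 2) * f (fiberPoint y l) ≤ G l := by
  obtain ⟨δ, hδ, g, hg, hfg⟩ := hf.dom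
  have hn' : (0 : ℝ) < n := by positivity
  have h1 := (measurePreserving_fiberPoint hn).integrable_comp_of_integrable hg
  have h2 := h1.prod_right_ae
  have hη : 0 < n * δ / 2 := by positivity
  obtain ⟨z, hz, hzi⟩ : ∃ z ∈ Metric.ball y₀ (n * δ / 2), Integrable (fun l =>
      (1 + ‖fiberPoint z l‖ ^ 2) * g (fiberPoint z l)) (slabMeasure n) := by
    by_contra! hcon
    have : volume (Metric.ball y₀ (n * δ / 2)) = 0 :=
      measure_mono_null (fun z hz => hcon z hz) (ae_iff.1 h2)
    exact (Metric.measure_ball_pos volume y₀ hη).ne' this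
  rw [Metric.mem_ball, Real.dist_eq] at hz
  -- Component sums within `n * δ / 2` of `y₀` differ from `z` by at most `n * δ`, a shift of at
  -- most `δ` per coordinate. The constant comes from `1 + (r + δ)² ≤ (2 + 2δ²)(1 + r²)`.
  refine ⟨n * δ / 2, hη, _, hzi.const_mul (2 + 2 * δ ^ 2), fun l y y' hy hy' => ?_⟩
  have key : ∀ x, |x - y₀| ≤ n * δ / 2 → |(x - z) / n| ≤ δ := fun x hx => by
    rw [abs_div, abs_of_pos hn', div_le_iff₀ hn']
    have := abs_sub_le x y₀ z
    rw [abs_sub_comm y₀ z] at this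
    linarith
  have hb : f (fiberPoint y l) ≤ g (fiberPoint z l) := by
    rw [fiberPoint_eq_add y z]; exact hfg _ _ (key y hy)
  have hnorm : ‖fiberPoint y' l‖ ≤ ‖fiberPoint z l‖ + δ := by
    rw [fiberPoint_eq_add y' z]
    refine (norm_add_le _ _).trans ?_
    gcongr
    rw [norm_smul, Real.norm_eq_abs]
    calc |(y' - z) / n| * ‖(1 : Fin n → ℝ)‖ ≤ δ * 1 := by
          gcongr
          · exact key y' hy'
          · exact (pi_norm_le_iff_of_nonneg zero_le_one).2 (by simp)
      _ = δ := mul_one _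
  have hpos := hf.pos (fiberPoint y l)
  have h0 := norm_nonneg (fiberPoint y' l)
  calc (1 + ‖fiberPoint y' l‖ ^ 2) * f (fiberPoint y l)
      ≤ ((2 + 2 * δ ^ 2) * (1 + ‖fiberPoint z l‖ ^ 2)) * g (fiberPoint z l) := by
        gcongr
        nlinarith [pow_le_pow_left₀ h0 hnorm 2, sq_nonneg (‖fiberPoint z l‖ - δ),
          sq_nonneg (δ * ‖fiberPoint z l‖)]
    _ = _ := by ring

lemma integrable_fiber (hn : 0 < n) {ψ : (Fin n → ℝ) → ℝ} (hψ : QuadGrowth ψ) (y : ℝ) :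
    Integrable (fun l => ψ (fiberPoint y l) * f (fiberPoint y l)) (slabMeasure n) := by
  obtain ⟨hc, C, hC⟩ := hψ
  obtain ⟨η, hη, G, hG, hb⟩ := hf.exists_local_bound hn y
  refine (hG.const_mul C).mono' ?_ (Eventually.of_forall fun l => ?_)
  · exact ((hc.mul hf.cont).comp (continuous_fiberPoint_right y)).aestronglyMeasurable
  · have h1 := hb l y y (by simpa using hη.le) (by simpa using hη.le)
    have h2 := hf.pos (fiberPoint y l)
    have h3 := hC (fiberPoint y l)
    have hC0 : 0 ≤ C := by
      by_contra! h
      nlinarith [abs_nonneg (ψ (fiberPoint y l)), sq_nonneg ‖fiberPoint y l‖]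
    rw [Real.norm_eq_abs, abs_mul, abs_of_pos h2]
    calc _ ≤ (C * (1 + ‖fiberPoint y l‖ ^ 2)) * f (fiberPoint y l) := by gcongr
      _ = C * ((1 + ‖fiberPoint y l‖ ^ 2) * f (fiberPoint y l)) := by ring
      _ ≤ _ := by gcongr

lemma continuous_fiberIntegral (hn : 0 < n) {ψ : (Fin n → ℝ) → ℝ} (hψ : QuadGrowth ψ) :
    Continuous (fiberIntegral f ψ) := by
  obtain ⟨hc, C, hC⟩ := hψ
  have hC0 : 0 ≤ C := by
    have := (abs_nonneg _).trans (hC 0)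
    simpa using this
  rw [continuous_iff_continuousAt]
  intro y₀
  obtain ⟨η, hη, G, hG, hb⟩ := hf.exists_local_bound hn y₀
  refine continuousAt_of_dominated (bound := fun l => C * G l) ?_ ?_ (hG.const_mul C) ?_
  · exact Eventually.of_forall fun y =>
      ((hc.mul hf.cont).comp (continuous_fiberPoint_right y)).aestronglyMeasurable
  · filter_upwards [Metric.closedBall_mem_nhds y₀ hη] with y hy
    refine Eventually.of_forall fun l => ?_
    rw [Metric.mem_closedBall, Real.dist_eq] at hy
    have h1 := hb l y y hy hy
    have h2 := hf.pos (fiberPoint y l)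
    have h3 := hC (fiberPoint y l)
    rw [Real.norm_eq_abs, abs_mul, abs_of_pos h2]
    calc _ ≤ (C * (1 + ‖fiberPoint y l‖ ^ 2)) * f (fiberPoint y l) := by gcongr
      _ = C * ((1 + ‖fiberPoint y l‖ ^ 2) * f (fiberPoint y l)) := by ring
      _ ≤ _ := by gcongr
  · exact Eventually.of_forall fun l =>
      ((hc.mul hf.cont).comp (continuous_fiberPoint_left l)).continuousAt

lemma fiberIntegral_one_pos (hn : 0 < n) (y : ℝ) : 0 < fiberIntegral f 1 y := by
  have hi := hf.integrable_fiber hn (ψ := 1) ⟨continuous_one, 1, fun l => by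
    simp⟩ y
  have hp : ∀ l, 0 < (1 : (Fin n → ℝ) → ℝ) (fiberPoint y l) * f (fiberPoint y l) := fun l => by
    simpa using hf.pos _
  refine (integral_pos_iff_support_of_nonneg (fun l => (hp l).le) hi).2 ?_
  have : Function.support (fun l => (1 : (Fin n → ℝ) → ℝ) (fiberPoint y l) * f (fiberPoint y l))
      = Set.univ := Set.eq_univ_of_forall fun l => (hp l).ne'
  rw [this]
  exact (Measure.measure_univ_pos).2 (slabMeasure_ne_zero hn)

lemma integral_indicator_eq_fiberIntegral (hn : 0 < n) {ψ : (Fin n → ℝ) → ℝ} (hψ : QuadGrowth ψ)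
    {s : Set ℝ} (hs : MeasurableSet s) :
    ∫ l, {l | 1 ⬝ᵥ l ∈ s}.indicator ψ l * f l = ∫ y in s, fiberIntegral f ψ y := by
  obtain ⟨hc, C, hC⟩ := hψ
  have hi := hf.integrable_mul hc.aestronglyMeasurable hC
  have hms : MeasurableSet {l : Fin n → ℝ | 1 ⬝ᵥ l ∈ s} :=
    continuous_one_dotProduct.measurable hs
  have heq : (fun l => {l | 1 ⬝ᵥ l ∈ s}.indicator ψ l * f l)
      = {l | 1 ⬝ᵥ l ∈ s}.indicator (fun l => ψ l * f l) := by
    ext l; rw [Set.indicator_mul_left]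
  rw [heq, integral_eq_integral_fiberPoint hn (hi.indicator hms), ← integral_indicator hs]
  congr 1; ext y
  by_cases hy : y ∈ s
  · rw [Set.indicator_of_mem hy, fiberIntegral]
    congr 1; ext l
    rw [Set.indicator_of_mem (by simpa [one_dotProduct_fiberPoint hn] using hy)]
  · rw [Set.indicator_of_notMem hy, ← integral_zero (Fin n → ℝ) ℝ (μ := slabMeasure n)]
    congr 1; ext l
    rw [Set.indicator_of_notMem (by simpa [one_dotProduct_fiberPoint hn] using hy)]

lemma integrable_fiberIntegral (hn : 0 < n) {ψ : (Fin n → ℝ) → ℝ} (hψ : QuadGrowth ψ) :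
    Integrable (fiberIntegral f ψ) := by
  obtain ⟨hc, C, hC⟩ := hψ
  have hi := hf.integrable_mul hc.aestronglyMeasurable hC
  exact ((measurePreserving_fiberPoint hn).integrable_comp_of_integrable hi).integral_prod_left

/-- The tail integral is an integral over `(y, ∞)` of a continuous fibre integral, so the
fundamental theorem of calculus applies. All the derivatives `f`, `K'` and `K[Z]'` come from here.
-/
lemma hasDerivAt_integral_indicator (hn : 0 < n) {ψ : (Fin n → ℝ) → ℝ} (hψ : QuadGrowth ψ)
    (y : ℝ) : HasDerivAt (fun y => ∫ l, {l | y < 1 ⬝ᵥ l}.indicator ψ l * f l)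
      (-fiberIntegral f ψ y) y := by
  have hi := hf.integrable_fiberIntegral hn hψ
  have hc := hf.continuous_fiberIntegral hn hψ
  have heq : (fun y => ∫ l, {l | y < 1 ⬝ᵥ l}.indicator ψ l * f l)
      = fun y => (∫ z in Set.Ioi 0, fiberIntegral f ψ z) - ∫ z in (0 : ℝ)..y, fiberIntegral f ψ z := by
    ext y
    rw [← intervalIntegral.integral_Ioi_sub_Ioi' hi.integrableOn hi.integrableOn, sub_sub_cancel]
    exact hf.integral_indicator_eq_fiberIntegral hn hψ measurableSet_Ioi
  rw [heq]
  exact (intervalIntegral.integral_hasDerivAt_right (hc.intervalIntegrable _ _)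
    hc.stronglyMeasurable.stronglyMeasurableAtFilter hc.continuousAt).const_sub _

end IsTameDensity

end Density

/-! ### The second order remainder of the positive part. -/

section Kink

/-- The remainder of the expansion of `a ↦ a⁺` at `a` to first order in the increment `-w`. -/
noncomputable def kink (a w : ℝ) : ℝ := max (a - w) 0 - max a 0 + if 0 < a then w else 0

lemma kink_nonneg (a w : ℝ) : 0 ≤ kink a w := by
  unfold kink
  split_ifs with h
  · rw [max_eq_left h.le]; linarith [le_max_left (a - w) 0]
  · rw [max_eq_right (not_lt.1 h)]; linarith [le_max_right (a - w) 0]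

lemma kink_le_abs (a w : ℝ) : kink a w ≤ |w| := by
  unfold kink
  split_ifs with h
  · rw [max_eq_left h.le]
    have : max (a - w) 0 ≤ a - w + |w| := max_le (by linarith [abs_nonneg w])
      (by linarith [le_abs_self w])
    linarith
  · rw [max_eq_right (not_lt.1 h)]
    have : max (a - w) 0 ≤ |w| := max_le (by linarith [neg_le_abs w]) (abs_nonneg w)
    linarith

lemma kink_eq_zero {a w : ℝ} (h : |w| ≤ |a|) : kink a w = 0 := by
  unfold kink
  split_ifs with h0
  · rw [abs_of_pos h0] at h
    rw [max_eq_left h0.le, max_eq_left (by linarith [le_abs_self w])]; ring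
  · rw [abs_of_nonpos (not_lt.1 h0)] at h
    rw [max_eq_right (not_lt.1 h0), max_eq_right (by linarith [neg_le_abs w])]; ring

/-- Along a line in direction `1` the increment is affine in `a`. Its slope is traded here for a
rescaling of `a`, after which the increment is constant on the line. -/
lemma kink_sub_mul (a w : ℝ) {c : ℝ} (hc : 0 < 1 + c) :
    kink a (w - a * c) = kink ((1 + c) * a) w := by
  unfold kink
  have h1 : a - (w - a * c) = (1 + c) * a - w := by ring
  rw [h1]
  by_cases h : 0 < a
  · have h2 : 0 < (1 + c) * a := by positivity
    rw [if_pos h, if_pos h2, max_eq_left h.le, max_eq_left h2.le]; ring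
  · have h2 : (1 + c) * a ≤ 0 := mul_nonpos_of_nonneg_of_nonpos hc.le (not_lt.1 h)
    rw [if_neg h, if_neg (not_lt.2 h2), max_eq_right (not_lt.1 h), max_eq_right h2]

/-- The kink is nonzero only if `|w| > |a| ≥ η`, and then `|w| ≤ w² / η`. -/
lemma kink_le_sq_div {a w η : ℝ} (hη : 0 < η) (ha : η ≤ |a|) : kink a w ≤ w ^ 2 / η := by
  rcases le_or_gt |w| |a| with h | h
  · rw [kink_eq_zero h]; positivity
  · refine (kink_le_abs a w).trans ?_
    rw [le_div_iff₀ hη, ← sq_abs w]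
    nlinarith [abs_nonneg w]

lemma measurable_kink : Measurable fun z : ℝ × ℝ => kink z.1 z.2 := by
  unfold kink
  exact ((by fun_prop : Measurable fun z : ℝ × ℝ => max (z.1 - z.2) 0 - max z.1 0)).add
    (Measurable.ite (measurableSet_lt measurable_const measurable_fst) measurable_snd
      measurable_const)

lemma kink_eq_indicator_of_nonneg {w : ℝ} (hw : 0 ≤ w) :
    (fun a => kink a w) = (Set.Ioc 0 w).indicator fun a => w - a := by
  ext a
  unfold kink
  by_cases h0 : 0 < a
  · by_cases h1 : a ≤ w
    · rw [Set.indicator_of_mem (show a ∈ Set.Ioc 0 w from ⟨h0, h1⟩), if_pos h0, max_eq_left h0.le,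
        max_eq_right (by linarith)]; ring
    · rw [Set.indicator_of_notMem (fun h => h1 h.2), if_pos h0, max_eq_left h0.le,
        max_eq_left (by linarith)]; ring
  · rw [Set.indicator_of_notMem (fun h => h0 h.1), if_neg h0, max_eq_right (not_lt.1 h0),
      max_eq_right (by linarith)]; ring

lemma kink_eq_indicator_of_nonpos {w : ℝ} (hw : w ≤ 0) :
    (fun a => kink a w) = (Set.Ioc w 0).indicator fun a => a - w := by
  ext a
  unfold kink
  by_cases h0 : 0 < a
  · rw [Set.indicator_of_notMem (fun h => not_le.2 h0 h.2), if_pos h0, max_eq_left h0.le,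
      max_eq_left (by linarith)]; ring
  · rw [if_neg h0, max_eq_right (not_lt.1 h0)]
    by_cases h1 : w < a
    · rw [Set.indicator_of_mem (show a ∈ Set.Ioc w 0 from ⟨h1, not_lt.1 h0⟩), max_eq_left (by linarith)]; ring
    · rw [Set.indicator_of_notMem (fun h => h1 h.1), max_eq_right (by linarith)]; ring

lemma integrable_kink (w : ℝ) : Integrable fun a => kink a w := by
  rcases le_total 0 w with h | h
  · rw [kink_eq_indicator_of_nonneg h, integrable_indicator_iff measurableSet_Ioc]
    exact (Continuous.integrableOn_Icc (by fun_prop)).mono_set Set.Ioc_subset_Icc_self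
  · rw [kink_eq_indicator_of_nonpos h, integrable_indicator_iff measurableSet_Ioc]
    exact (Continuous.integrableOn_Icc (by fun_prop)).mono_set Set.Ioc_subset_Icc_self

/-- The graph bounds a right triangle with both legs `|w|`. -/
lemma integral_kink (w : ℝ) : ∫ a, kink a w = w ^ 2 / 2 := by
  rcases le_total 0 w with h | h
  · rw [kink_eq_indicator_of_nonneg h, integral_indicator measurableSet_Ioc,
      ← intervalIntegral.integral_of_le h, intervalIntegral.integral_sub (by simp) (by simp)]
    simp
    ring
  · rw [kink_eq_indicator_of_nonpos h, integral_indicator measurableSet_Ioc,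
      ← intervalIntegral.integral_of_le h, intervalIntegral.integral_sub (by simp) (by simp)]
    simp
    ring

lemma integrable_kink_comp (w q : ℝ) {k : ℝ} (hk : 0 < k) :
    Integrable fun y => kink (k * (y - q)) w :=
  ((integrable_kink w).comp_mul_left' hk.ne').comp_sub_right q

lemma integral_kink_comp (w q : ℝ) {k : ℝ} (hk : 0 < k) :
    ∫ y, kink (k * (y - q)) w = w ^ 2 / (2 * k) := by
  rw [integral_sub_right_eq_self (fun y => kink (k * y) w) q,
    Measure.integral_comp_mul_left (fun y => kink y w), integral_kink, smul_eq_mul,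
    abs_of_pos (by positivity)]
  field_simp

lemma setIntegral_kink_mul_le {w q k B : ℝ} (hk : 0 < k) {h : ℝ → ℝ} {s : Set ℝ}
    (hs : MeasurableSet s) (hB : ∀ y ∈ s, |h y| ≤ B) (hB0 : 0 ≤ B) :
    |∫ y in s, kink (k * (y - q)) w * h y| ≤ B * (w ^ 2 / (2 * k)) := by
  have hi := integrable_kink_comp w q hk
  calc |∫ y in s, kink (k * (y - q)) w * h y|
      ≤ ∫ y in s, B * kink (k * (y - q)) w := by
        rw [← Real.norm_eq_abs]
        refine norm_integral_le_of_norm_le (hi.integrableOn.const_mul B) ?_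
        filter_upwards [ae_restrict_mem hs] with y hy
        rw [Real.norm_eq_abs, abs_mul, abs_of_nonneg (kink_nonneg _ _), mul_comm]
        have := kink_nonneg (k * (y - q)) w
        gcongr
        exact hB y hy
    _ ≤ ∫ y, B * kink (k * (y - q)) w :=
        setIntegral_le_integral (hi.const_mul B)
          (Eventually.of_forall fun y => mul_nonneg hB0 (kink_nonneg _ _))
    _ = _ := by rw [integral_const_mul, integral_kink_comp w q hk]

/-- The kinks `kink ((1 + c) (y - q)) w` concentrate at `q` as `w, c → 0`. -/
lemma isLittleO_setIntegral_kink_mul {ι : Type*} {l : Filter ι} {w c : ι → ℝ} {q η : ℝ}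
    {h : ℝ → ℝ} (hη : 0 < η) (hc : Tendsto c l (𝓝 0)) (hw : Tendsto w l (𝓝 0))
    (hh : Continuous h) :
    (fun i => (∫ y in Metric.closedBall q η, kink ((1 + c i) * (y - q)) (w i) * h y)
      - w i ^ 2 / 2 * h q) =o[l] fun i => w i ^ 2 := by
  rw [isLittleO_iff]
  intro ε hε
  -- Two errors are budgeted: `ε' w²` for the variation of `h` near `q`, and `ε' w² |h q|` for the
  -- factor `1 + c` in the area of the kink.
  obtain ⟨ε', hε', hε'ε⟩ : ∃ ε' > 0, ε' * (1 + |h q|) ≤ ε :=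
    ⟨ε / (1 + |h q|), by positivity, by rw [div_mul_cancel₀]; positivity⟩
  obtain ⟨θ, hθ, hθh⟩ := Metric.continuousAt_iff.1 (hh.continuousAt (x := q)) ε' hε'
  -- Since `1 + c > 1 / 2`, the kink lives in `|y - q| ≤ 2 |w|`, which these bounds place inside
  -- both the `θ`-ball and the `η`-ball.
  have hm : 0 < min (θ / 4) (η / 2) := by positivity
  filter_upwards [hc.eventually (Metric.ball_mem_nhds 0 (show (0:ℝ) < min (1/2) ε' by positivity)),
    hw.eventually (Metric.ball_mem_nhds 0 hm)] with i hci hwi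
  simp only [dist_zero_right, Real.norm_eq_abs, lt_min_iff] at hci hwi
  obtain ⟨hc1, hc2⟩ := hci
  obtain ⟨hw1, hw2⟩ := hwi
  set c := c i
  set w := w i
  have hcl := neg_abs_le c
  have hcu := le_abs_self c
  have hk : 0 < 1 + c := by linarith
  have hsmall : ∀ y, 2 * |w| < |y - q| → kink ((1 + c) * (y - q)) w = 0 := fun y hy => by
    apply kink_eq_zero
    rw [abs_mul, abs_of_pos hk]
    nlinarith [abs_nonneg (y - q)]
  have hi := integrable_kink_comp w q hk
  have hfull : ∫ y in Metric.closedBall q η, kink ((1 + c) * (y - q)) w = w ^ 2 / (2 * (1 + c)) := by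
    rw [← integral_kink_comp w q hk]
    apply setIntegral_eq_integral_of_forall_compl_eq_zero
    intro y hy
    rw [Metric.mem_closedBall, Real.dist_eq, not_le] at hy
    exact hsmall y (by linarith)
  have hcont : ContinuousOn h (Metric.closedBall q η) := hh.continuousOn
  have hi2 : IntegrableOn (fun y => kink ((1 + c) * (y - q)) w * h y)
      (Metric.closedBall q η) := by
    obtain ⟨B, hB⟩ := (isCompact_closedBall q η).exists_bound_of_continuousOn hcont
    exact (hi.integrableOn (s := Metric.closedBall q η)).mul_bdd (c := B)
      hh.aestronglyMeasurable
      ((ae_restrict_mem Metric.isClosed_closedBall.measurableSet).mono fun y hy => hB y hy)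
  have hdiff : ∫ y in Metric.closedBall q η, kink ((1 + c) * (y - q)) w * h y =
      (∫ y in Metric.closedBall q η, kink ((1 + c) * (y - q)) w *
        (Metric.ball q θ).indicator (fun y => h y - h q) y) + w ^ 2 / (2 * (1 + c)) * h q := by
    rw [← hfull, ← integral_mul_const, ← sub_eq_iff_eq_add,
      ← integral_sub hi2 (hi.integrableOn.mul_const _)]
    refine setIntegral_congr_fun Metric.isClosed_closedBall.measurableSet fun y _ => ?_
    by_cases hy : y ∈ Metric.ball q θ
    · rw [Set.indicator_of_mem hy]; ring
    · rw [Metric.mem_ball, Real.dist_eq, not_lt] at hy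
      rw [hsmall y (by linarith [abs_nonneg w])]; ring
  have hbd := setIntegral_kink_mul_le (w := w) (q := q) (B := ε') hk
    (h := (Metric.ball q θ).indicator (fun y => h y - h q))
    (Metric.isClosed_closedBall (x := q) (ε := η)).measurableSet (fun y _ => by
      by_cases hy : y ∈ Metric.ball q θ
      · rw [Set.indicator_of_mem hy]; exact (hθh hy).le
      · rw [Set.indicator_of_notMem hy, abs_zero]; exact hε'.le) hε'.le
  have hw3 : w ^ 2 / (2 * (1 + c)) ≤ w ^ 2 :=
    div_le_self (sq_nonneg w) (by linarith)
  have hlin : |w ^ 2 / (2 * (1 + c)) - w ^ 2 / 2| ≤ ε' * w ^ 2 := by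
    have : w ^ 2 / (2 * (1 + c)) - w ^ 2 / 2 = -c * (w ^ 2 / (2 * (1 + c))) := by
      field_simp; ring
    rw [this, abs_mul, abs_neg, abs_of_nonneg (show 0 ≤ w ^ 2 / (2 * (1 + c)) by positivity)]
    gcongr
  rw [hdiff, Real.norm_eq_abs, Real.norm_eq_abs, abs_of_nonneg (sq_nonneg w)]
  set I := ∫ y in Metric.closedBall q η, kink ((1 + c) * (y - q)) w *
        (Metric.ball q θ).indicator (fun y => h y - h q) y
  calc |I + w ^ 2 / (2 * (1 + c)) * h q - w ^ 2 / 2 * h q|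
      = |I + (w ^ 2 / (2 * (1 + c)) - w ^ 2 / 2) * h q| := by congr 1; ring
    _ ≤ |I| + |w ^ 2 / (2 * (1 + c)) - w ^ 2 / 2| * |h q| := by
        rw [← abs_mul]; exact abs_add_le _ _
    _ ≤ ε' * w ^ 2 + ε' * w ^ 2 * |h q| := by
        gcongr
        exact hbd.trans (by gcongr)
    _ = ε' * (1 + |h q|) * w ^ 2 := by ring
    _ ≤ ε * w ^ 2 := by gcongr

end Kink

/-- Dominated convergence for `F i / s i`. The bound forces `F i = 0` wherever `s i = 0`, so the
division loses nothing. -/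
lemma isLittleO_integral_of_dominated {α ι : Type*} [MeasurableSpace α] {μ : Measure α}
    {l : Filter ι} [l.IsCountablyGenerated] {F : ι → α → ℝ} {s : ι → ℝ} {G : α → ℝ}
    (hF : ∀ᶠ i in l, AEStronglyMeasurable (F i) μ)
    (hb : ∀ᶠ i in l, ∀ a, |F i a| ≤ G a * |s i|) (hG : Integrable G μ)
    (ho : ∀ a, (fun i => F i a) =o[l] s) : (fun i => ∫ a, F i a ∂μ) =o[l] s := by
  have hz : ∀ᶠ i in l, s i = 0 → ∀ a, F i a = 0 := by
    filter_upwards [hb] with i hi hs a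
    have := hi a
    rwa [hs, abs_zero, mul_zero, abs_nonpos_iff] at this
  rw [isLittleO_iff_tendsto' (by filter_upwards [hz] with i hi hs; simp [hi hs])]
  have : Tendsto (fun i => ∫ a, F i a / s i ∂μ) l (𝓝 (∫ _, (0 : ℝ) ∂μ)) := by
    refine tendsto_integral_filter_of_dominated_convergence (fun a => |G a|) ?_ ?_ hG.abs ?_
    · filter_upwards [hF] with i hi using hi.mul_const (s i)⁻¹
    · filter_upwards [hb] with i hi
      refine Eventually.of_forall fun a => ?_
      rw [Real.norm_eq_abs, abs_div]
      exact div_le_of_le_mul₀ (abs_nonneg _) (abs_nonneg _)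
        ((hi a).trans (by gcongr; exact le_abs_self _))
    · exact Eventually.of_forall fun a => (ho a).tendsto_div_nhds_zero
  simpa only [integral_div, integral_zero] using this

/-! ### Expansion of the mean kink for a fixed asset fluctuation. -/

section KinkMean

variable {n : ℕ}

lemma abs_dotProduct_le (u l : Fin n → ℝ) : |u ⬝ᵥ l| ≤ n * (‖u‖ * ‖l‖) := by
  calc |u ⬝ᵥ l| ≤ ∑ i, |u i * l i| := Finset.abs_sum_le_sum_abs _ _
    _ ≤ ∑ _i : Fin n, ‖u‖ * ‖l‖ := by
        gcongr with i
        rw [abs_mul]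
        gcongr
        · exact norm_le_pi_norm u i
        · exact norm_le_pi_norm l i
    _ = n * (‖u‖ * ‖l‖) := by simp

lemma abs_sub_dotProduct_le (z : ℝ × (Fin n → ℝ)) (l : Fin n → ℝ) :
    |z.1 - z.2 ⬝ᵥ l| ≤ ‖z‖ * (1 + n * ‖l‖) := by
  have h1 : |z.1| ≤ ‖z‖ := norm_fst_le z
  have h2 : ‖z.2‖ ≤ ‖z‖ := norm_snd_le z
  calc |z.1 - z.2 ⬝ᵥ l| ≤ |z.1| + |z.2 ⬝ᵥ l| := abs_sub _ _
    _ ≤ ‖z‖ + n * (‖z‖ * ‖l‖) := by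
        gcongr
        exact (abs_dotProduct_le _ _).trans (by gcongr)
    _ = _ := by ring

lemma sq_sub_dotProduct_le (z : ℝ × (Fin n → ℝ)) (l : Fin n → ℝ) :
    (z.1 - z.2 ⬝ᵥ l) ^ 2 ≤ 2 * (1 + n ^ 2) * ‖z‖ ^ 2 * (1 + ‖l‖ ^ 2) := by
  rw [← sq_abs]
  calc |z.1 - z.2 ⬝ᵥ l| ^ 2 ≤ (‖z‖ * (1 + n * ‖l‖)) ^ 2 := by
        gcongr; exact abs_sub_dotProduct_le z l
    _ = ‖z‖ ^ 2 * (1 + n * ‖l‖) ^ 2 := by ring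
    _ ≤ ‖z‖ ^ 2 * (2 * (1 + n ^ 2) * (1 + ‖l‖ ^ 2)) := by
        gcongr
        nlinarith [sq_nonneg (1 - n * ‖l‖), sq_nonneg ‖l‖, sq_nonneg (n : ℝ)]
    _ = _ := by ring

lemma continuous_dotProduct_right (u : Fin n → ℝ) : Continuous fun l : Fin n → ℝ => u ⬝ᵥ l := by
  unfold dotProduct; fun_prop

lemma continuous_dotProduct_left (l : Fin n → ℝ) : Continuous fun u : Fin n → ℝ => u ⬝ᵥ l := by
  unfold dotProduct; fun_prop

lemma quadGrowth_sq_sub_dotProduct (b : ℝ) (u : Fin n → ℝ) :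
    QuadGrowth fun l : Fin n → ℝ => (b - u ⬝ᵥ l) ^ 2 := by
  refine ⟨?_, 2 * (1 + n ^ 2) * ‖(b, u)‖ ^ 2, fun l => ?_⟩
  · have := continuous_dotProduct_right u
    fun_prop
  · rw [abs_of_nonneg (sq_nonneg _)]
    exact sq_sub_dotProduct_le (b, u) l

lemma dotProduct_fiberPoint (u : Fin n → ℝ) (y q : ℝ) (l : Fin n → ℝ) :
    u ⬝ᵥ fiberPoint y l = u ⬝ᵥ fiberPoint q l + (y - q) * ((u ⬝ᵥ 1) / n) := by
  rw [fiberPoint_eq_add y q, dotProduct_add, dotProduct_smul, smul_eq_mul]; ring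

/-- The mean of `kink (⟨1, L⟩ - q) (b - ⟨u, L⟩)` for `L` with density `f`. -/
noncomputable def kinkMean (f : (Fin n → ℝ) → ℝ) (q b : ℝ) (u : Fin n → ℝ) : ℝ :=
  ∫ l, kink (1 ⬝ᵥ l - q) (b - u ⬝ᵥ l) * f l

lemma measurable_kink_dotProduct (q b : ℝ) (u : Fin n → ℝ) :
    Measurable fun l : Fin n → ℝ => kink (1 ⬝ᵥ l - q) (b - u ⬝ᵥ l) :=
  measurable_kink.comp ((continuous_one_dotProduct.measurable.sub_const q).prodMk
    ((continuous_dotProduct_right u).measurable.const_sub b))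

lemma indicator_kink_fiberPoint (hn : 0 < n) (f : (Fin n → ℝ) → ℝ) (q η b : ℝ) (u l : Fin n → ℝ)
    (y : ℝ) :
    {l | η < |1 ⬝ᵥ l - q|}ᶜ.indicator (fun l => kink (1 ⬝ᵥ l - q) (b - u ⬝ᵥ l) * f l)
      (fiberPoint y l) =
    (Metric.closedBall q η).indicator (fun y => kink (y - q) (b - u ⬝ᵥ fiberPoint q l
      - (y - q) * ((u ⬝ᵥ 1) / n)) * f (fiberPoint y l)) y := by
  by_cases hy : y ∈ Metric.closedBall q η
  · rw [Set.indicator_of_mem hy, Set.indicator_of_mem, one_dotProduct_fiberPoint hn,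
      dotProduct_fiberPoint u y q, sub_sub]
    rw [Metric.mem_closedBall, Real.dist_eq] at hy
    simpa [one_dotProduct_fiberPoint hn] using hy
  · rw [Set.indicator_of_notMem hy, Set.indicator_of_notMem]
    rw [Metric.mem_closedBall, Real.dist_eq] at hy
    simpa [one_dotProduct_fiberPoint hn] using hy

namespace IsTameDensity

variable {f : (Fin n → ℝ) → ℝ} (hf : IsTameDensity f)
include hf

lemma integrable_kink_mul (q b : ℝ) (u : Fin n → ℝ) :
    Integrable fun l => kink (1 ⬝ᵥ l - q) (b - u ⬝ᵥ l) * f l := by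
  refine hf.integrable_mul (C := ‖(b, u)‖ * (1 + n))
    (measurable_kink_dotProduct q b u).aestronglyMeasurable fun l => ?_
  rw [abs_of_nonneg (kink_nonneg _ _)]
  refine (kink_le_abs _ _).trans ((abs_sub_dotProduct_le (b, u) l).trans ?_)
  rw [mul_assoc]
  gcongr
  nlinarith [norm_nonneg l, sq_nonneg (‖l‖ - 1), sq_nonneg ‖l‖, (Nat.cast_nonneg n : (0:ℝ) ≤ n),
    mul_nonneg (Nat.cast_nonneg n : (0:ℝ) ≤ n) (sq_nonneg (‖l‖ - 1)),
    mul_nonneg (Nat.cast_nonneg n : (0:ℝ) ≤ n) (sq_nonneg ‖l‖)]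

/-- For each fixed `l` with component sum away from `q` the kink is eventually zero as `z → 0`, and
`kink_le_sq_div` supplies a dominating function of order `‖z‖²`. -/
lemma isLittleO_integral_kink_far (q : ℝ) {η : ℝ} (hη : 0 < η) :
    (fun z : ℝ × (Fin n → ℝ) => ∫ l, {l | η < |1 ⬝ᵥ l - q|}.indicator
      (fun l => kink (1 ⬝ᵥ l - q) (z.1 - z.2 ⬝ᵥ l) * f l) l) =o[𝓝 0] fun z => ‖z‖ ^ 2 := by
  have hms : MeasurableSet {l : Fin n → ℝ | η < |1 ⬝ᵥ l - q|} :=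
    measurableSet_lt measurable_const
      (continuous_abs.measurable.comp (continuous_one_dotProduct.measurable.sub_const q))
  refine isLittleO_integral_of_dominated
    (G := fun l => 2 * (1 + n ^ 2) / η * ((1 + ‖l‖ ^ 2) * f l)) ?_ ?_ ?_ ?_
  · exact Eventually.of_forall fun z =>
      ((hf.integrable_kink_mul q z.1 z.2).indicator hms).aestronglyMeasurable
  · refine Eventually.of_forall fun z l => ?_
    have hp := hf.pos l
    by_cases hl : η < |1 ⬝ᵥ l - q|
    · rw [Set.indicator_of_mem (by exact hl), abs_of_nonneg (mul_nonneg (kink_nonneg _ _) hp.le),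
        abs_of_nonneg (sq_nonneg _)]
      calc _ ≤ (z.1 - z.2 ⬝ᵥ l) ^ 2 / η * f l := by
            gcongr; exact kink_le_sq_div hη hl.le
        _ ≤ (2 * (1 + n ^ 2) * ‖z‖ ^ 2 * (1 + ‖l‖ ^ 2)) / η * f l := by
            gcongr; exact sq_sub_dotProduct_le z l
        _ = _ := by ring
    · rw [Set.indicator_of_notMem (by exact hl), abs_zero]
      positivity
  · exact hf.integrable_sq.const_mul _
  · intro l
    have hev : ∀ᶠ z : ℝ × (Fin n → ℝ) in 𝓝 0, ‖z‖ * (1 + n * ‖l‖) < η := by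
      have : Tendsto (fun z : ℝ × (Fin n → ℝ) => ‖z‖ * (1 + n * ‖l‖)) (𝓝 0) (𝓝 0) := by
        have : Continuous fun z : ℝ × (Fin n → ℝ) => ‖z‖ * (1 + n * ‖l‖) := by fun_prop
        simpa using this.tendsto 0
      exact this.eventually (gt_mem_nhds hη)
    refine (isLittleO_zero (E' := ℝ) (fun z : ℝ × (Fin n → ℝ) => ‖z‖ ^ 2) (𝓝 0)).congr' ?_
      EventuallyEq.rfl
    filter_upwards [hev] with z hz
    by_cases hl : η < |1 ⬝ᵥ l - q|
    · rw [Set.indicator_of_mem (by exact hl),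
        kink_eq_zero ((abs_sub_dotProduct_le z l).trans (hz.le.trans hl.le)), zero_mul]
    · rw [Set.indicator_of_notMem (by exact hl)]

lemma integral_kink_near_eq (hn : 0 < n) (q η : ℝ) (b : ℝ) (u : Fin n → ℝ) :
    ∫ l, {l | η < |1 ⬝ᵥ l - q|}ᶜ.indicator
      (fun l => kink (1 ⬝ᵥ l - q) (b - u ⬝ᵥ l) * f l) l =
    ∫ l, (∫ y in Metric.closedBall q η, kink (y - q) (b - u ⬝ᵥ fiberPoint q l
      - (y - q) * ((u ⬝ᵥ 1) / n)) * f (fiberPoint y l)) ∂slabMeasure n := by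
  have hms : MeasurableSet {l : Fin n → ℝ | η < |1 ⬝ᵥ l - q|}ᶜ :=
    (measurableSet_lt measurable_const
      (continuous_abs.measurable.comp (continuous_one_dotProduct.measurable.sub_const q))).compl
  have hi := (hf.integrable_kink_mul q b u).indicator hms
  rw [integral_eq_integral_fiberPoint hn hi, integral_integral_swap]
  · congr 1; ext l
    rw [← integral_indicator Metric.isClosed_closedBall.measurableSet]
    congr 1; ext y
    exact indicator_kink_fiberPoint hn f q η b u l y
  · exact (measurePreserving_fiberPoint hn).integrable_comp_of_integrable hi

lemma aestronglyMeasurable_integral_kink_near (q η : ℝ) (b : ℝ) (u : Fin n → ℝ) :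
    AEStronglyMeasurable (fun l => ∫ y in Metric.closedBall q η, kink (y - q)
      (b - u ⬝ᵥ fiberPoint q l - (y - q) * ((u ⬝ᵥ 1) / n)) * f (fiberPoint y l))
      (slabMeasure n) := by
  have h1 := continuous_fiberPoint (n := n)
  have h2 : Continuous fun z : (Fin n → ℝ) × ℝ => f (fiberPoint z.2 z.1) :=
    hf.cont.comp (h1.comp continuous_swap)
  have h3 : Continuous fun z : (Fin n → ℝ) × ℝ =>
      b - u ⬝ᵥ fiberPoint q z.1 - (z.2 - q) * ((u ⬝ᵥ 1) / n) := by
    have := (continuous_dotProduct_right u).comp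
      ((continuous_fiberPoint_right (n := n) q).comp (continuous_fst (Y := ℝ)))
    simp only [Function.comp_def] at this
    fun_prop
  have h4 : Measurable fun z : (Fin n → ℝ) × ℝ => kink (z.2 - q)
      (b - u ⬝ᵥ fiberPoint q z.1 - (z.2 - q) * ((u ⬝ᵥ 1) / n)) :=
    measurable_kink.comp ((measurable_snd.sub_const q).prodMk h3.measurable)
  exact ((h4.mul h2.measurable).stronglyMeasurable.integral_prod_right
    (ν := volume.restrict (Metric.closedBall q η))).aestronglyMeasurable

/-- Second order expansion of the mean of the kink. -/
theorem isLittleO_kinkMean (hn : 0 < n) (q : ℝ) :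
    (fun z : ℝ × (Fin n → ℝ) => kinkMean f q z.1 z.2
      - fiberIntegral f (fun l => (z.1 - z.2 ⬝ᵥ l) ^ 2) q / 2) =o[𝓝 0] fun z => ‖z‖ ^ 2 := by
  obtain ⟨η, hη, G, hG, hGb⟩ := hf.exists_local_bound hn q
  have hfar := hf.isLittleO_integral_kink_far q hη
  have hms : MeasurableSet {l : Fin n → ℝ | η < |1 ⬝ᵥ l - q|} :=
    measurableSet_lt measurable_const
      (continuous_abs.measurable.comp (continuous_one_dotProduct.measurable.sub_const q))
  set N : ℝ × (Fin n → ℝ) → (Fin n → ℝ) → ℝ := fun z l => ∫ y in Metric.closedBall q η,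
    kink (y - q) (z.1 - z.2 ⬝ᵥ fiberPoint q l - (y - q) * ((z.2 ⬝ᵥ 1) / n)) * f (fiberPoint y l)
    with hN
  have hc : Tendsto (fun z : ℝ × (Fin n → ℝ) => (z.2 ⬝ᵥ 1) / (n : ℝ)) (𝓝 0) (𝓝 0) := by
    have : Continuous fun z : ℝ × (Fin n → ℝ) => (z.2 ⬝ᵥ 1) / (n : ℝ) :=
      ((continuous_dotProduct_left (1 : Fin n → ℝ)).comp continuous_snd).div_const _
    simpa using this.tendsto 0
  -- The lower bound `1 / 2` on the rescaling factor keeps the kink's area `w² / (2 (1 + c))` below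
  -- `w²`.
  have hN' : ∀ᶠ z : ℝ × (Fin n → ℝ) in 𝓝 0, 1 / 2 < 1 + (z.2 ⬝ᵥ 1) / (n : ℝ) ∧
      ∀ l, N z l = ∫ y in Metric.closedBall q η, kink ((1 + (z.2 ⬝ᵥ 1) / (n : ℝ)) * (y - q))
        (z.1 - z.2 ⬝ᵥ fiberPoint q l) * f (fiberPoint y l) := by
    filter_upwards [hc.eventually (lt_mem_nhds (show -(1 / 2 : ℝ) < 0 by norm_num))] with z hz
    refine ⟨by linarith, fun l => ?_⟩
    simp only [hN]
    congr 1; ext y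
    rw [kink_sub_mul _ _ (by linarith)]
  have hnear : (fun z : ℝ × (Fin n → ℝ) => ∫ l, N z l - (z.1 - z.2 ⬝ᵥ fiberPoint q l) ^ 2 / 2
      * f (fiberPoint q l) ∂slabMeasure n) =o[𝓝 0] fun z => ‖z‖ ^ 2 := by
    -- The kink integral and its limit are each at most `w²` times `G l / (1 + ‖fiberPoint q l‖²)`,
    -- and `w² ≤ 2 (1 + n²) ‖z‖² (1 + ‖fiberPoint q l‖²)`.
    refine isLittleO_integral_of_dominated (G := fun l => 4 * (1 + n ^ 2) * G l) ?_ ?_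
      (hG.const_mul _) ?_
    · refine Eventually.of_forall fun z => ?_
      refine (hf.aestronglyMeasurable_integral_kink_near q η z.1 z.2).sub ?_
      have h1 := continuous_fiberPoint_right (n := n) q
      have h2 := (continuous_dotProduct_right z.2).comp h1
      have h3 := hf.cont.comp h1
      simp only [Function.comp_def] at h2 h3
      exact ((((continuous_const.sub h2).pow 2).div_const 2).mul h3).aestronglyMeasurable
    · filter_upwards [hN'] with z ⟨hz, hzN⟩ l
      have hG0 : ∀ y ∈ Metric.closedBall q η, |f (fiberPoint y l)|
          ≤ G l / (1 + ‖fiberPoint q l‖ ^ 2) := fun y hy => by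
        rw [abs_of_pos (hf.pos _), le_div_iff₀ (by positivity), mul_comm]
        exact hGb l y q (by simpa [Real.dist_eq] using hy) (by simpa using hη.le)
      have hw := sq_sub_dotProduct_le z (fiberPoint q l)
      have hGq := hG0 q (Metric.mem_closedBall_self hη.le)
      have hGn : 0 ≤ G l / (1 + ‖fiberPoint q l‖ ^ 2) := (abs_nonneg _).trans hGq
      rw [abs_of_pos (hf.pos _)] at hGq
      have hb1 := setIntegral_kink_mul_le (w := z.1 - z.2 ⬝ᵥ fiberPoint q l) (q := q)
        (by linarith : 0 < 1 + (z.2 ⬝ᵥ 1) / (n : ℝ)) Metric.isClosed_closedBall.measurableSet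
        hG0 hGn
      rw [← hzN l] at hb1
      have hle : (z.1 - z.2 ⬝ᵥ fiberPoint q l) ^ 2 / (2 * (1 + (z.2 ⬝ᵥ 1) / (n : ℝ)))
          ≤ (z.1 - z.2 ⬝ᵥ fiberPoint q l) ^ 2 := div_le_self (sq_nonneg _) (by linarith)
      have hp := hf.pos (fiberPoint q l)
      rw [abs_of_nonneg (sq_nonneg ‖z‖)]
      have hne : 1 + ‖fiberPoint q l‖ ^ 2 ≠ 0 := by positivity
      calc _ ≤ |N z l| + |(z.1 - z.2 ⬝ᵥ fiberPoint q l) ^ 2 / 2 * f (fiberPoint q l)| := abs_sub _ _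
        _ ≤ G l / (1 + ‖fiberPoint q l‖ ^ 2) * (z.1 - z.2 ⬝ᵥ fiberPoint q l) ^ 2 +
            (z.1 - z.2 ⬝ᵥ fiberPoint q l) ^ 2 * (G l / (1 + ‖fiberPoint q l‖ ^ 2)) := by
            rw [abs_of_nonneg (show 0 ≤ (z.1 - z.2 ⬝ᵥ fiberPoint q l) ^ 2 / 2 *
              f (fiberPoint q l) by positivity)]
            refine add_le_add (hb1.trans (by gcongr)) ?_
            gcongr
            linarith [sq_nonneg (z.1 - z.2 ⬝ᵥ fiberPoint q l)]
        _ = 2 * (G l / (1 + ‖fiberPoint q l‖ ^ 2)) * (z.1 - z.2 ⬝ᵥ fiberPoint q l) ^ 2 := by ring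
        _ ≤ 2 * (G l / (1 + ‖fiberPoint q l‖ ^ 2)) *
            (2 * (1 + n ^ 2) * ‖z‖ ^ 2 * (1 + ‖fiberPoint q l‖ ^ 2)) := by gcongr
        _ = _ := by field_simp; ring
    · intro l
      have hw : Tendsto (fun z : ℝ × (Fin n → ℝ) => z.1 - z.2 ⬝ᵥ fiberPoint q l) (𝓝 0) (𝓝 0) := by
        have : Continuous fun z : ℝ × (Fin n → ℝ) => z.1 - z.2 ⬝ᵥ fiberPoint q l :=
          continuous_fst.sub ((continuous_dotProduct_left _).comp continuous_snd)
        simpa using this.tendsto 0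
      have ho := isLittleO_setIntegral_kink_mul (q := q) hη hc hw
        (hf.cont.comp (continuous_fiberPoint_left l))
      have hO : (fun z : ℝ × (Fin n → ℝ) => (z.1 - z.2 ⬝ᵥ fiberPoint q l) ^ 2)
          =O[𝓝 0] fun z => ‖z‖ ^ 2 := by
        refine IsBigO.of_bound (2 * (1 + n ^ 2) * (1 + ‖fiberPoint q l‖ ^ 2))
          (Eventually.of_forall fun z => ?_)
        rw [Real.norm_eq_abs, Real.norm_eq_abs, abs_of_nonneg (sq_nonneg _),
          abs_of_nonneg (sq_nonneg _)]
        exact (sq_sub_dotProduct_le z _).trans (le_of_eq (by ring))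
      refine (ho.trans_isBigO hO).congr' ?_ EventuallyEq.rfl
      filter_upwards [hN'] with z ⟨_, hzN⟩
      rw [hzN l]; rfl
  refine (hfar.add hnear).congr_left fun z => ?_
  have hi := hf.integrable_kink_mul q z.1 z.2
  have hne := hf.integral_kink_near_eq hn q η z.1 z.2
  have hiN : Integrable (N z) (slabMeasure n) := by
    have h1 := (measurePreserving_fiberPoint hn).integrable_comp_of_integrable
      (hi.indicator hms.compl)
    refine h1.integral_prod_right.congr (Eventually.of_forall fun l => ?_)
    simp only [hN]
    rw [← integral_indicator Metric.isClosed_closedBall.measurableSet]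
    congr 1; ext y
    exact indicator_kink_fiberPoint hn f q η z.1 z.2 l y
  have hi2 := hf.integrable_fiber hn (quadGrowth_sq_sub_dotProduct z.1 z.2) q
  have hi3 : Integrable (fun l => (z.1 - z.2 ⬝ᵥ fiberPoint q l) ^ 2 / 2 * f (fiberPoint q l))
      (slabMeasure n) := (hi2.div_const 2).congr (Eventually.of_forall fun l => by ring)
  have hsplit : kinkMean f q z.1 z.2 = (∫ l, {l | η < |1 ⬝ᵥ l - q|}.indicator
      (fun l => kink (1 ⬝ᵥ l - q) (z.1 - z.2 ⬝ᵥ l) * f l) l) + ∫ l, N z l ∂slabMeasure n := by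
    rw [← hne, integral_indicator hms, integral_indicator hms.compl, integral_add_compl hms hi]
    rfl
  rw [hsplit, integral_sub hiN hi3, fiberIntegral, ← integral_div, add_sub_assoc]
  congr 3
  ext l; ring

end IsTameDensity

end KinkMean

/-! ### Value-at-risk, and the Rockafellar-Uryasev formula for expected shortfall. -/

section ExpectedShortfall

variable {Ω : Type*} [MeasurableSpace Ω] {P : Measure Ω} [IsProbabilityMeasure P] {Z : Ω → ℝ}

lemma real_add_neg_eq_one_sub_cdf (hZ : Measurable Z) (m : ℝ) :
    P.real {ω | Z ω + m < 0} = 1 - cdf (P.map fun ω => -Z ω) m := by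
  have : IsProbabilityMeasure (P.map fun ω => -Z ω) :=
    Measure.isProbabilityMeasure_map hZ.neg.aemeasurable
  have hn : Measurable fun ω => -Z ω := hZ.neg
  rw [cdf_eq_real, map_measureReal_apply hn measurableSet_Iic,
    ← probReal_compl_eq_one_sub (hn measurableSet_Iic)]
  congr 1; ext ω
  simp only [Set.mem_ofPred_eq, Set.mem_compl_iff, Set.mem_preimage, Set.mem_Iic, not_le]
  constructor <;> intro h <;> linarith

/-- Right continuity of the distribution function of `-Z` makes the infimum attained; its limits at
`±∞` make the set nonempty and bounded below for levels strictly between 0 and 1. -/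
lemma VaR_le_iff (hZ : Measurable Z) {β : ℝ} (hβ : β ∈ Set.Ioo (0 : ℝ) 1) (m : ℝ) :
    VaR P β Z ≤ m ↔ P.real {ω | Z ω + m < 0} ≤ β := by
  have hprob : IsProbabilityMeasure (P.map fun ω => -Z ω) :=
    Measure.isProbabilityMeasure_map hZ.neg.aemeasurable
  set F := cdf (P.map fun ω => -Z ω) with hF
  have hset : {m : ℝ | P.real {ω | Z ω + m < 0} ≤ β} = {m | 1 - β ≤ F m} := by
    ext m
    rw [Set.mem_ofPred_eq, Set.mem_ofPred_eq, real_add_neg_eq_one_sub_cdf hZ, ← hF]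
    constructor <;> intro h <;> linarith
  have hmem : P.real {ω | Z ω + m < 0} ≤ β ↔ 1 - β ≤ F m := Set.ext_iff.1 hset m
  rw [VaR, hset, hmem]
  have hbdd : BddBelow {m | 1 - β ≤ F m} := by
    obtain ⟨b, hb⟩ := ((tendsto_cdf_atBot (P.map fun ω => -Z ω)).eventually
      (gt_mem_nhds (show 0 < 1 - β by linarith [hβ.2]))).exists
    refine ⟨b, fun m hm => ?_⟩
    by_contra! h
    exact absurd (hm.trans (monotone_cdf _ h.le)) (not_le.2 hb)
  have hne : {m | 1 - β ≤ F m}.Nonempty := by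
    obtain ⟨b, hb⟩ := ((tendsto_cdf_atTop (P.map fun ω => -Z ω)).eventually
      (lt_mem_nhds (show 1 - β < 1 by linarith [hβ.1]))).exists
    exact ⟨b, hb.le⟩
  refine ⟨fun h => ?_, fun h => csInf_le hbdd h⟩
  have hr : Tendsto F (𝓝[>] m) (𝓝 (F m)) :=
    ((F.right_continuous m).mono Set.Ioi_subset_Ici_self)
  refine ge_of_tendsto hr ?_
  filter_upwards [self_mem_nhdsWithin] with m' hm'
  obtain ⟨s, hs, hsm⟩ := (csInf_lt_iff hbdd hne).1 (h.trans_lt hm')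
  have hs' : 1 - β ≤ F s := hs
  exact hs'.trans (monotone_cdf _ hsm.le)

lemma antitoneOn_VaR (hZ : Measurable Z) : AntitoneOn (fun β => VaR P β Z) (Set.Ioo 0 1) :=
  fun _ hβ _ hβ' h => (VaR_le_iff hZ hβ' _).2 (((VaR_le_iff hZ hβ _).1 le_rfl).trans h)

/-- The quantile transform: under the uniform law of the level, `VaR` has the law of `-Z`. -/
lemma map_VaR (hZ : Measurable Z) :
    (volume.restrict (Set.Ioo (0 : ℝ) 1)).map (fun β => VaR P β Z) = P.map fun ω => -Z ω := by
  have hprob : IsProbabilityMeasure (P.map fun ω => -Z ω) :=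
    Measure.isProbabilityMeasure_map hZ.neg.aemeasurable
  have hae := aemeasurable_restrict_of_antitoneOn (μ := volume) measurableSet_Ioo
    (antitoneOn_VaR (P := P) hZ)
  have hfin : IsFiniteMeasure ((volume.restrict (Set.Ioo (0 : ℝ) 1)).map
      (fun β => VaR P β Z)) := by
    have : IsFiniteMeasure (volume.restrict (Set.Ioo (0 : ℝ) 1)) :=
      ⟨by simp⟩
    infer_instance
  refine Measure.ext_of_Iic _ _ fun m => ?_
  have hr := real_add_neg_eq_one_sub_cdf (P := P) hZ m
  set c := P.real {ω | Z ω + m < 0} with hc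
  have hc0 : 0 ≤ c := measureReal_nonneg
  have hc1 : c ≤ 1 := measureReal_le_one
  have hF : P.map (fun ω => -Z ω) (Set.Iic m) = ENNReal.ofReal (1 - c) := by
    rw [← ofReal_cdf]; congr 1; linarith
  rw [hF, Measure.map_apply_of_aemeasurable hae measurableSet_Iic,
    Measure.restrict_apply₀' measurableSet_Ioo.nullMeasurableSet]
  have hset : (fun β => VaR P β Z) ⁻¹' Set.Iic m ∩ Set.Ioo 0 1 = Set.Ici c ∩ Set.Ioo 0 1 := by
    ext β
    simp only [Set.mem_inter_iff, Set.mem_preimage, Set.mem_Iic, Set.mem_Ici]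
    constructor
    · rintro ⟨h, hβ⟩; exact ⟨(VaR_le_iff hZ hβ m).1 h, hβ⟩
    · rintro ⟨h, hβ⟩; exact ⟨(VaR_le_iff hZ hβ m).2 h, hβ⟩
  rw [hset]
  -- Sandwiching between the open and the closed interval from `c` to `1` avoids treating `c = 0`
  -- separately.
  apply le_antisymm
  · rw [← Real.volume_Icc]
    exact measure_mono fun β hβ => ⟨hβ.1, hβ.2.2.le⟩
  · rw [← Real.volume_Ioo]
    exact measure_mono fun β hβ => ⟨hβ.1.le, hc0.trans_lt hβ.1, hβ.2⟩

lemma integrableOn_VaR (hZ : Measurable Z) (hi : Integrable Z P) :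
    IntegrableOn (fun β => VaR P β Z) (Set.Ioo 0 1) := by
  have hae := aemeasurable_restrict_of_antitoneOn (μ := volume) measurableSet_Ioo
    (antitoneOn_VaR (P := P) hZ)
  have h1 : Integrable id (P.map fun ω => -Z ω) :=
    (integrable_map_measure aestronglyMeasurable_id hZ.neg.aemeasurable).2 hi.neg
  rw [← map_VaR hZ] at h1
  exact (integrable_map_measure aestronglyMeasurable_id hae).1 h1

lemma setIntegral_max_VaR (hZ : Measurable Z) (m : ℝ) :
    ∫ β in Set.Ioo (0 : ℝ) 1, max (VaR P β Z - m) 0 = ∫ ω, max (-Z ω - m) 0 ∂P := by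
  have hae := aemeasurable_restrict_of_antitoneOn (μ := volume) measurableSet_Ioo
    (antitoneOn_VaR (P := P) hZ)
  have hc : Continuous fun x : ℝ => max (x - m) 0 := by fun_prop
  have hn : Measurable fun ω => -Z ω := hZ.neg
  rw [← integral_map (f := fun x : ℝ => max (x - m) 0) hae hc.aestronglyMeasurable, map_VaR hZ,
    integral_map hn.aemeasurable hc.aestronglyMeasurable]

variable {α : ℝ} (hα : α ∈ Set.Ioo (0 : ℝ) 1) (hZ : Measurable Z) (hi : Integrable Z P)
include hα hZ hi

lemma mul_ES_eq_add_setIntegral (m : ℝ) :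
    α * ES P α Z = α * m + ∫ β in Set.Ioc (0 : ℝ) α, (VaR P β Z - m) := by
  have hsub : Set.Ioc (0 : ℝ) α ⊆ Set.Ioo 0 1 := fun β hβ => ⟨hβ.1, hβ.2.trans_lt hα.2⟩
  rw [ES, ← mul_assoc, mul_inv_cancel₀ hα.1.ne', one_mul,
    intervalIntegral.integral_of_le hα.1.le,
    integral_sub ((integrableOn_VaR hZ hi).mono_set hsub) (integrable_const m)]
  simp [hα.1.le]

/-- Passing to the positive part and enlarging `(0, α]` to `(0, 1)` can only increase the integral
of `VaR - m`. -/
lemma mul_ES_le (m : ℝ) : α * ES P α Z ≤ α * m + ∫ ω, max (-Z ω - m) 0 ∂P := by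
  have hsub : Set.Ioc (0 : ℝ) α ⊆ Set.Ioo 0 1 := fun β hβ => ⟨hβ.1, hβ.2.trans_lt hα.2⟩
  have hV : IntegrableOn (fun β => VaR P β Z - m) (Set.Ioo 0 1) :=
    (integrableOn_VaR hZ hi).sub (integrable_const m)
  rw [mul_ES_eq_add_setIntegral hα hZ hi m, ← setIntegral_max_VaR hZ]
  gcongr
  calc _ ≤ ∫ β in Set.Ioc (0 : ℝ) α, max (VaR P β Z - m) 0 :=
        integral_mono (hV.mono_set hsub) (hV.pos_part.mono_measure
          (Measure.restrict_mono hsub le_rfl)) fun β => le_max_left _ _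
    _ ≤ _ := setIntegral_mono_set hV.pos_part (Eventually.of_forall fun β => le_max_right _ _)
        hsub.eventuallyLE

/-- At `m = VaR_α` both inequalities are equalities: by monotonicity `VaR_β - m` is nonnegative for
`β ≤ α` and nonpositive for `β ≥ α`. -/
lemma mul_ES_eq : α * ES P α Z =
    α * VaR P α Z + ∫ ω, max (-Z ω - VaR P α Z) 0 ∂P := by
  have hsub : Set.Ioc (0 : ℝ) α ⊆ Set.Ioo 0 1 := fun β hβ => ⟨hβ.1, hβ.2.trans_lt hα.2⟩
  rw [mul_ES_eq_add_setIntegral hα hZ hi (VaR P α Z), ← setIntegral_max_VaR hZ]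
  congr 1
  calc _ = ∫ β in Set.Ioc (0 : ℝ) α, max (VaR P β Z - VaR P α Z) 0 := by
        refine setIntegral_congr_fun measurableSet_Ioc fun β hβ => ?_
        exact (max_eq_left (sub_nonneg.2 (antitoneOn_VaR (P := P) hZ (hsub hβ) hα hβ.2))).symm
    _ = _ := by
        refine (setIntegral_eq_of_subset_of_forall_sdiff_eq_zero measurableSet_Ioo hsub
          fun β hβ => ?_).symm
        have h : α ≤ β := by
          by_contra! h
          exact hβ.2 ⟨hβ.1.1, h.le⟩
        exact max_eq_right (sub_nonpos.2 (antitoneOn_VaR (P := P) hZ hα hβ.1 h))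

end ExpectedShortfall

/-! ### Fibre integrals of quadratic polynomials. -/

section QuadPoly

variable {n : ℕ}

/-- The quadratic polynomial `a + ⟨b, l⟩ + ⟨l, A l⟩`. -/
def quadPoly (a : ℝ) (b : Fin n → ℝ) (A : Matrix (Fin n) (Fin n) ℝ) (l : Fin n → ℝ) : ℝ :=
  a + ∑ i, b i * l i + ∑ i, ∑ j, A i j * (l i * l j)

lemma quadGrowth_one : QuadGrowth (1 : (Fin n → ℝ) → ℝ) :=
  ⟨continuous_one, 1, fun l => by simp⟩

lemma quadGrowth_coord (i : Fin n) : QuadGrowth fun l : Fin n → ℝ => l i :=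
  ⟨continuous_apply i, 1, fun l => by
    have : |l i| ≤ ‖l‖ := norm_le_pi_norm l i
    nlinarith [sq_nonneg (‖l‖ - 1), sq_nonneg ‖l‖]⟩

lemma quadGrowth_coord_mul (i j : Fin n) : QuadGrowth fun l : Fin n → ℝ => l i * l j :=
  ⟨by fun_prop, 1, fun l => by
    rw [abs_mul]
    have h1 : |l i| ≤ ‖l‖ := norm_le_pi_norm l i
    have h2 : |l j| ≤ ‖l‖ := norm_le_pi_norm l j
    nlinarith [mul_le_mul h1 h2 (abs_nonneg _) (norm_nonneg _)]⟩

lemma QuadGrowth.add {ψ χ : (Fin n → ℝ) → ℝ} (hψ : QuadGrowth ψ) (hχ : QuadGrowth χ) :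
    QuadGrowth fun l => ψ l + χ l := by
  obtain ⟨hc, C, hC⟩ := hψ
  obtain ⟨hd, D, hD⟩ := hχ
  refine ⟨hc.add hd, C + D, fun l => (abs_add_le _ _).trans ?_⟩
  rw [add_mul]
  exact add_le_add (hC l) (hD l)

lemma QuadGrowth.const_mul {ψ : (Fin n → ℝ) → ℝ} (hψ : QuadGrowth ψ) (c : ℝ) :
    QuadGrowth fun l => c * ψ l := by
  obtain ⟨hc, C, hC⟩ := hψ
  refine ⟨hc.const_mul c, |c| * C, fun l => ?_⟩
  rw [abs_mul, mul_assoc]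
  gcongr
  exact hC l

lemma QuadGrowth.sum {ι : Type*} (s : Finset ι) {ψ : ι → (Fin n → ℝ) → ℝ}
    (hψ : ∀ i, QuadGrowth (ψ i)) : QuadGrowth fun l => ∑ i ∈ s, ψ i l := by
  classical
  induction s using Finset.induction_on with
  | empty => exact ⟨by simpa using continuous_const, 0, fun l => by simp⟩
  | insert i s hi ih => simpa only [Finset.sum_insert hi] using (hψ i).add ih

lemma quadGrowth_quadPoly (a : ℝ) (b : Fin n → ℝ) (A : Matrix (Fin n) (Fin n) ℝ) :
    QuadGrowth (quadPoly a b A) := by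
  have h1 : QuadGrowth fun _ : Fin n → ℝ => a := by
    simpa using (quadGrowth_one (n := n)).const_mul a
  exact (h1.add (QuadGrowth.sum _ fun i => (quadGrowth_coord i).const_mul (b i))).add
    (QuadGrowth.sum _ fun i => QuadGrowth.sum _ fun j =>
      (quadGrowth_coord_mul i j).const_mul (A i j))

lemma fiberIntegral_const_mul (f ψ : (Fin n → ℝ) → ℝ) (c y : ℝ) :
    fiberIntegral f (fun l => c * ψ l) y = c * fiberIntegral f ψ y := by
  simp only [fiberIntegral, mul_assoc, integral_const_mul]

namespace IsTameDensity

variable {f : (Fin n → ℝ) → ℝ} (hf : IsTameDensity f) (hn : 0 < n)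
include hf hn

lemma fiberIntegral_add {ψ χ : (Fin n → ℝ) → ℝ} (hψ : QuadGrowth ψ) (hχ : QuadGrowth χ) (y : ℝ) :
    fiberIntegral f (fun l => ψ l + χ l) y = fiberIntegral f ψ y + fiberIntegral f χ y := by
  simp only [fiberIntegral, add_mul]
  exact integral_add (hf.integrable_fiber hn hψ y) (hf.integrable_fiber hn hχ y)

lemma fiberIntegral_sum {ι : Type*} (s : Finset ι) {ψ : ι → (Fin n → ℝ) → ℝ}
    (hψ : ∀ i, QuadGrowth (ψ i)) (y : ℝ) :
    fiberIntegral f (fun l => ∑ i ∈ s, ψ i l) y = ∑ i ∈ s, fiberIntegral f (ψ i) y := by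
  simp only [fiberIntegral, Finset.sum_mul]
  exact integral_finsetSum _ fun i _ => hf.integrable_fiber hn (hψ i) y

/-- Both the derivative of `KQuad` and the fibre integral of `w²` thereby become combinations of the
same fibre moments and can be compared coefficientwise. -/
lemma fiberIntegral_quadPoly (a : ℝ) (b : Fin n → ℝ) (A : Matrix (Fin n) (Fin n) ℝ) (y : ℝ) :
    fiberIntegral f (quadPoly a b A) y = a * fiberIntegral f 1 y
      + ∑ i, b i * fiberIntegral f (fun l => l i) y
      + ∑ i, ∑ j, A i j * fiberIntegral f (fun l => l i * l j) y := by
  have hc0 : QuadGrowth fun _ : Fin n → ℝ => a := by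
    simpa using (quadGrowth_one (n := n)).const_mul a
  have hc1 := fun i => (quadGrowth_coord (n := n) i).const_mul (b i)
  have hc2 := fun i j => (quadGrowth_coord_mul (n := n) i j).const_mul (A i j)
  have h0 : fiberIntegral f (fun _ => a) y = a * fiberIntegral f 1 y := by
    rw [← fiberIntegral_const_mul]; simp
  unfold quadPoly
  rw [hf.fiberIntegral_add hn (hc0.add (QuadGrowth.sum _ hc1))
      (QuadGrowth.sum _ fun i => QuadGrowth.sum _ (hc2 i)),
    hf.fiberIntegral_add hn hc0 (QuadGrowth.sum _ hc1), hf.fiberIntegral_sum hn _ hc1,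
    hf.fiberIntegral_sum hn _ fun i => QuadGrowth.sum _ (hc2 i), h0]
  simp only [hf.fiberIntegral_sum hn _ (hc2 _), fiberIntegral_const_mul]

end IsTameDensity

lemma sq_sub_dotProduct_eq_quadPoly (b : ℝ) (u : Fin n → ℝ) :
    (fun l : Fin n → ℝ => (b - u ⬝ᵥ l) ^ 2)
      = quadPoly (b ^ 2) (-(2 * b) • u) (Matrix.vecMulVec u u) := by
  ext l
  have h1 : ∑ i, (-(2 * b) • u) i * l i = -(2 * b) * (u ⬝ᵥ l) := by
    rw [dotProduct, Finset.mul_sum]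
    exact Finset.sum_congr rfl fun i _ => by simp [mul_assoc]
  have h2 : ∑ i, ∑ j, Matrix.vecMulVec u u i j * (l i * l j) = (u ⬝ᵥ l) * (u ⬝ᵥ l) := by
    rw [dotProduct, Finset.sum_mul_sum]
    refine Finset.sum_congr rfl fun i _ => Finset.sum_congr rfl fun j _ => ?_
    rw [Matrix.vecMulVec_apply]; ring
  rw [quadPoly, h1, h2]; ring

lemma quadForm_sub_eq_quadPoly {A : Matrix (Fin n) (Fin n) ℝ} (hA : A.IsSymm) (φ : Fin n → ℝ) :
    (fun l : Fin n → ℝ => (φ - l) ⬝ᵥ A *ᵥ (φ - l))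
      = quadPoly (φ ⬝ᵥ A *ᵥ φ) ((-2 : ℝ) • A *ᵥ φ) A := by
  ext l
  have h1 : ∑ i, ((-2 : ℝ) • A *ᵥ φ) i * l i = -2 * (l ⬝ᵥ A *ᵥ φ) := by
    rw [dotProduct, Finset.mul_sum]
    exact Finset.sum_congr rfl fun i _ => by simp; ring
  have h2 : ∑ i, ∑ j, A i j * (l i * l j) = l ⬝ᵥ A *ᵥ l := by
    simp only [dotProduct, Matrix.mulVec, Finset.mul_sum]
    exact Finset.sum_congr rfl fun i _ => Finset.sum_congr rfl fun j _ => by ring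
  have h3 : φ ⬝ᵥ A *ᵥ l = l ⬝ᵥ A *ᵥ φ := by
    rw [Matrix.dotProduct_mulVec, ← Matrix.mulVec_transpose, hA.eq, dotProduct_comm]
  rw [quadPoly, h1, h2, Matrix.mulVec_sub, sub_dotProduct, dotProduct_sub, dotProduct_sub, h3]
  ring

end QuadPoly

/-! ### The law of the aggregate claim, its quantile, and the derivatives of `KVec` and `KQuad`. -/

section Claims

variable {Ω : Type*} [MeasurableSpace Ω] {P : Measure Ω} {n : ℕ} {L : Ω → Fin n → ℝ}
  {f : (Fin n → ℝ) → ℝ}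

/-- `L` has the tame density `f`. -/
structure HasTameDensity (P : Measure Ω) (L : Ω → Fin n → ℝ) (f : (Fin n → ℝ) → ℝ) : Prop where
  n_pos : 0 < n
  measurable : Measurable L
  map_eq : P.map L = volume.withDensity fun l => ENNReal.ofReal (f l)
  tame : IsTameDensity f

namespace HasTameDensity

variable (h : HasTameDensity P L f)
include h

lemma integral_map_eq (ψ : (Fin n → ℝ) → ℝ) : ∫ l, ψ l ∂P.map L = ∫ l, ψ l * f l := by
  rw [h.map_eq, integral_withDensity_eq_integral_toReal_smul
    (h.tame.cont.measurable.ennreal_ofReal) (by simp)]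
  congr 1; ext l
  rw [ENNReal.toReal_ofReal (h.tame.pos l).le, smul_eq_mul, mul_comm]

lemma integrable_map_iff (ψ : (Fin n → ℝ) → ℝ) :
    Integrable ψ (P.map L) ↔ Integrable fun l => ψ l * f l := by
  rw [h.map_eq, integrable_withDensity_iff_integrable_smul'
    (h.tame.cont.measurable.ennreal_ofReal) (by simp)]
  refine integrable_congr (Eventually.of_forall fun l => ?_)
  simp only
  rw [ENNReal.toReal_ofReal (h.tame.pos l).le, smul_eq_mul, mul_comm]

lemma integral_comp {ψ : (Fin n → ℝ) → ℝ} (hψ : Measurable ψ) :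
    ∫ ω, ψ (L ω) ∂P = ∫ l, ψ l * f l := by
  rw [← integral_map h.measurable.aemeasurable hψ.aestronglyMeasurable, h.integral_map_eq]

lemma integrable_comp {ψ : (Fin n → ℝ) → ℝ} (hψ : QuadGrowth ψ) :
    Integrable (fun ω => ψ (L ω)) P := by
  obtain ⟨hc, C, hC⟩ := hψ
  exact (integrable_map_measure hc.aestronglyMeasurable h.measurable.aemeasurable).1
    ((h.integrable_map_iff ψ).2 (h.tame.integrable_mul hc.aestronglyMeasurable hC))

lemma measurable_total : Measurable fun ω => 1 ⬝ᵥ L ω :=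
  continuous_one_dotProduct.measurable.comp h.measurable

lemma integrable_total : Integrable (fun ω => 1 ⬝ᵥ L ω) P := by
  refine (h.integrable_comp (QuadGrowth.sum Finset.univ fun i => quadGrowth_coord i)).congr
    (Eventually.of_forall fun ω => ?_)
  simp [dotProduct]

lemma integral_indicator_comp {ψ : (Fin n → ℝ) → ℝ} (hψ : Measurable ψ) (y : ℝ) :
    ∫ ω, {ω | y < 1 ⬝ᵥ L ω}.indicator (fun ω => ψ (L ω)) ω ∂P
      = ∫ l, {l | y < 1 ⬝ᵥ l}.indicator ψ l * f l := by
  have hms : MeasurableSet {l : Fin n → ℝ | y < 1 ⬝ᵥ l} :=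
    measurableSet_lt measurable_const continuous_one_dotProduct.measurable
  rw [← h.integral_comp (hψ.indicator hms)]
  rfl

lemma hasDerivAt_integral_indicator_comp {ψ : (Fin n → ℝ) → ℝ} (hψ : QuadGrowth ψ) (y : ℝ) :
    HasDerivAt (fun y => ∫ ω, {ω | y < 1 ⬝ᵥ L ω}.indicator (fun ω => ψ (L ω)) ω ∂P)
      (-fiberIntegral f ψ y) y := by
  simp_rw [h.integral_indicator_comp hψ.1.measurable]
  exact h.tame.hasDerivAt_integral_indicator h.n_pos hψ y

lemma hasDerivAt_KVec (y : ℝ) :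
    HasDerivAt (KVec P L) (fun i => -fiberIntegral f (fun l => l i) y) y := by
  refine hasDerivAt_pi.2 fun i => ?_
  have heq : (fun y => KVec P L y i)
      = fun y => ∫ ω, {ω | y < 1 ⬝ᵥ L ω}.indicator (fun ω => L ω i) ω ∂P := by
    ext y
    have hms : MeasurableSet {ω | y < 1 ⬝ᵥ L ω} :=
      measurableSet_lt measurable_const h.measurable_total
    have hi : Integrable L P := Integrable.of_eval fun i => h.integrable_comp (quadGrowth_coord i)
    rw [KVec, eval_integral fun i => ((hi.indicator hms).eval i)]
    congr 1; ext ω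
    by_cases hω : ω ∈ {ω | y < 1 ⬝ᵥ L ω}
    · rw [Set.indicator_of_mem hω, Set.indicator_of_mem hω]
    · rw [Set.indicator_of_notMem hω, Set.indicator_of_notMem hω]; rfl
  rw [heq]
  exact h.hasDerivAt_integral_indicator_comp (quadGrowth_coord i) y

lemma hasDerivAt_aggCdf [IsProbabilityMeasure P] (y : ℝ) :
    HasDerivAt (aggCdf P L) (fiberIntegral f 1 y) y := by
  have h1 := (h.hasDerivAt_integral_indicator_comp (quadGrowth_one (n := n)) y).const_sub 1
  rw [neg_neg] at h1
  refine h1.congr_of_eventuallyEq (Eventually.of_forall fun y => ?_)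
  have hms : MeasurableSet {ω | y < 1 ⬝ᵥ L ω} :=
    measurableSet_lt measurable_const h.measurable_total
  have h2 := integral_indicator_const (μ := P) (1 : ℝ) hms
  rw [smul_eq_mul, mul_one] at h2
  simp only [Pi.one_apply]
  rw [h2, ← probReal_compl_eq_one_sub hms, aggCdf]
  congr 1; ext ω; simp

lemma aggDensity_eq [IsProbabilityMeasure P] : aggDensity P L = fiberIntegral f 1 :=
  funext fun y => (h.hasDerivAt_aggCdf y).deriv

lemma map_total_eq [IsProbabilityMeasure P] : P.map (fun ω => 1 ⬝ᵥ L ω)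
    = volume.withDensity fun y => ENNReal.ofReal (aggDensity P L y) := by
  have hpos : ∀ y, 0 ≤ fiberIntegral f 1 y := fun y => (h.tame.fiberIntegral_one_pos h.n_pos y).le
  ext s hs
  have hms : MeasurableSet {l : Fin n → ℝ | 1 ⬝ᵥ l ∈ s} := continuous_one_dotProduct.measurable hs
  have h1 := h.tame.integral_indicator_eq_fiberIntegral h.n_pos (quadGrowth_one (n := n)) hs
  rw [← h.integral_comp (measurable_one.indicator hms)] at h1
  have h2 : ∫ ω, {l : Fin n → ℝ | 1 ⬝ᵥ l ∈ s}.indicator 1 (L ω) ∂P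
      = P.real ((fun ω => 1 ⬝ᵥ L ω) ⁻¹' s) := by
    have := integral_indicator_const (μ := P) (1 : ℝ) (h.measurable_total hs)
    rw [smul_eq_mul, mul_one] at this
    rw [← this]
    rfl
  rw [h2] at h1
  rw [Measure.map_apply h.measurable_total hs, withDensity_apply _ hs, h.aggDensity_eq,
    ← ofReal_integral_eq_lintegral_ofReal
      (h.tame.integrable_fiberIntegral h.n_pos (quadGrowth_one (n := n))).integrableOn
      (Eventually.of_forall hpos), ← ofReal_measureReal, h1]

lemma real_neg_total_add_lt [IsProbabilityMeasure P] (m : ℝ) :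
    P.real {ω | -(1 ⬝ᵥ L ω) + m < 0} = 1 - aggCdf P L m := by
  have hms : MeasurableSet {ω | 1 ⬝ᵥ L ω ≤ m} :=
    measurableSet_le h.measurable_total measurable_const
  rw [aggCdf, ← probReal_compl_eq_one_sub hms]
  congr 1; ext ω
  simp only [Set.mem_ofPred_eq, Set.mem_compl_iff, not_le]
  constructor <;> intro hω <;> linarith

/-- Below the quantile the distribution function is less than `1 - α`; continuity carries the
inequality to the quantile itself. -/
lemma aggCdf_aggQuantile [IsProbabilityMeasure P] {α : ℝ} (hα : α ∈ Set.Ioo (0 : ℝ) 1) :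
    aggCdf P L (aggQuantile P L α) = 1 - α := by
  have hneg : Measurable fun ω => -(1 ⬝ᵥ L ω) := h.measurable_total.neg
  have hiff := VaR_le_iff (P := P) hneg hα
  have hq : ∀ m, aggQuantile P L α ≤ m ↔ 1 - α ≤ aggCdf P L m := fun m => by
    rw [aggQuantile, hiff m, h.real_neg_total_add_lt m]
    constructor <;> intro h <;> linarith
  refine le_antisymm ?_ ((hq _).1 le_rfl)
  have hc : Tendsto (aggCdf P L) (𝓝[<] aggQuantile P L α) (𝓝 (aggCdf P L (aggQuantile P L α))) :=
    (h.hasDerivAt_aggCdf _).continuousAt.tendsto.mono_left nhdsWithin_le_nhds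
  refine le_of_tendsto hc ?_
  filter_upwards [self_mem_nhdsWithin] with m hm
  by_contra! hcon
  exact absurd ((hq m).2 hcon.le) (not_le.2 hm)

lemma real_aggQuantile_lt [IsProbabilityMeasure P] {α : ℝ} (hα : α ∈ Set.Ioo (0 : ℝ) 1) :
    P.real {ω | aggQuantile P L α < 1 ⬝ᵥ L ω} = α := by
  have h1 := h.real_neg_total_add_lt (aggQuantile P L α)
  rw [h.aggCdf_aggQuantile hα, sub_sub_cancel] at h1
  refine Eq.trans ?_ h1
  congr 1; ext ω
  simp only [Set.mem_ofPred_eq]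
  constructor <;> intro hω <;> linarith

end HasTameDensity

lemma covMatrix_isSymm (P : Measure Ω) (X : Ω → Fin n → ℝ) : (covMatrix P X).IsSymm :=
  Matrix.IsSymm.ext fun _ _ => covariance_comm _ _

namespace HasTameDensity

variable (h : HasTameDensity P L f)
include h

lemma hasDerivAt_KQuad_sub (X : Ω → Fin n → ℝ) (φ : Fin n → ℝ) (y : ℝ) :
    HasDerivAt (KQuad P L X fun ω => φ - L ω)
      (-((φ ⬝ᵥ covMatrix P X *ᵥ φ) * fiberIntegral f 1 y
        - 2 * ∑ i, (covMatrix P X *ᵥ φ) i * fiberIntegral f (fun l => l i) y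
        + ∑ i, ∑ j, covMatrix P X i j * fiberIntegral f (fun l => l i * l j) y)) y := by
  have h1 := h.hasDerivAt_integral_indicator_comp
    (quadGrowth_quadPoly (φ ⬝ᵥ covMatrix P X *ᵥ φ) ((-2 : ℝ) • covMatrix P X *ᵥ φ) (covMatrix P X)) y
  rw [h.tame.fiberIntegral_quadPoly h.n_pos,
    ← quadForm_sub_eq_quadPoly (covMatrix_isSymm P X)] at h1
  refine h1.congr_deriv ?_
  rw [Finset.mul_sum, sub_eq_add_neg, ← Finset.sum_neg_distrib]
  congr 3
  exact Finset.sum_congr rfl fun i _ => by simp [mul_assoc]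

lemma hasDerivAt_KQuad (X : Ω → Fin n → ℝ) (y : ℝ) :
    HasDerivAt (KQuad P L X L)
      (-∑ i, ∑ j, covMatrix P X i j * fiberIntegral f (fun l => l i * l j) y) y := by
  have h1 := h.hasDerivAt_KQuad_sub X 0 y
  have heq : KQuad P L X (fun ω => 0 - L ω) = KQuad P L X L := by
    ext y
    simp only [KQuad, zero_sub, Matrix.mulVec_neg, dotProduct_neg, neg_dotProduct, neg_neg]
  rw [heq] at h1
  simpa using h1

lemma esExpansion_eq [IsProbabilityMeasure P] (α : ℝ) (X : Ω → Fin n → ℝ) (φ : Fin n → ℝ) :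
    esExpansion P α L X φ = ES P α (fun ω => -(1 ⬝ᵥ L ω)) + 1 / (2 * α) *
        ((φ ⬝ᵥ covMatrix P X *ᵥ φ) * aggDensity P L (aggQuantile P L α)
          + 2 * ((covMatrix P X *ᵥ φ) ⬝ᵥ deriv (KVec P L) (aggQuantile P L α))
          - deriv (KQuad P L X L) (aggQuantile P L α)) := by
  rw [esExpansion, (h.hasDerivAt_KQuad_sub X φ _).deriv, (h.hasDerivAt_KQuad X _).deriv,
    (h.hasDerivAt_KVec _).deriv, h.aggDensity_eq]
  have hdot : ∀ v w : Fin n → ℝ, (v ⬝ᵥ fun i => -w i) = -∑ i, v i * w i := fun v w => by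
    simp [dotProduct]
  rw [hdot]
  ring

end HasTameDensity

end Claims

/-! ### A bound on the expansion error valid for all fluctuations. -/

section PointwiseBound

variable {n : ℕ} {f : (Fin n → ℝ) → ℝ} (hf : IsTameDensity f) (hn : 0 < n)
include hf

lemma IsTameDensity.kinkMean_le (q b : ℝ) (u : Fin n → ℝ) :
    |kinkMean f q b u| ≤ ‖(b, u)‖ * ∫ l, (1 + n * ‖l‖) * f l := by
  have hlin : Integrable fun l => (1 + n * ‖l‖) * f l := by
    refine hf.integrable_mul (C := 1 + n) (by fun_prop) fun l => ?_
    rw [abs_of_nonneg (by positivity)]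
    nlinarith [norm_nonneg l, sq_nonneg ‖l‖, (Nat.cast_nonneg n : (0:ℝ) ≤ n),
      mul_nonneg (Nat.cast_nonneg n : (0:ℝ) ≤ n) (sq_nonneg (‖l‖ - 1)),
      mul_nonneg (Nat.cast_nonneg n : (0:ℝ) ≤ n) (sq_nonneg ‖l‖)]
  rw [kinkMean, ← integral_const_mul, ← Real.norm_eq_abs]
  refine norm_integral_le_of_norm_le (hlin.const_mul _) (Eventually.of_forall fun l => ?_)
  have hp := hf.pos l
  rw [Real.norm_of_nonneg (mul_nonneg (kink_nonneg _ _) hp.le), ← mul_assoc]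
  gcongr
  exact (kink_le_abs _ _).trans (abs_sub_dotProduct_le (b, u) l)

include hn

lemma IsTameDensity.fiberIntegral_sq_le (q b : ℝ) (u : Fin n → ℝ) :
    |fiberIntegral f (fun l => (b - u ⬝ᵥ l) ^ 2) q| ≤ ‖(b, u)‖ ^ 2 *
      (2 * (1 + n ^ 2) * fiberIntegral f (fun l => 1 + ‖l‖ ^ 2) q) := by
  have hq : QuadGrowth fun l : Fin n → ℝ => 1 + ‖l‖ ^ 2 :=
    ⟨by fun_prop, 1, fun l => by rw [abs_of_nonneg (by positivity), one_mul]⟩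
  rw [← mul_assoc, fiberIntegral, fiberIntegral, ← integral_const_mul, ← Real.norm_eq_abs]
  refine norm_integral_le_of_norm_le ((hf.integrable_fiber hn hq q).const_mul _)
    (Eventually.of_forall fun l => ?_)
  have hp := hf.pos (fiberPoint q l)
  rw [Real.norm_of_nonneg (by positivity), ← mul_assoc]
  gcongr
  exact (sq_sub_dotProduct_le (b, u) _).trans (le_of_eq (by ring))

/-- For `‖u‖ ≤ η` this is the local expansion. For `‖u‖ > η ≥ |m|` both terms are estimated
separately: the linear bound on `kinkMean` is at most a multiple of `‖u‖² / η`, so everything is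
charged to the tail. -/
lemma IsTameDensity.exists_kinkMean_bound (q : ℝ) (φ : Fin n → ℝ) {ε : ℝ} (hε : 0 < ε) :
    ∃ η > 0, ∃ C ≥ 0, ∀ (m : ℝ) (u : Fin n → ℝ), |m| ≤ η →
      |kinkMean f q (m + u ⬝ᵥ φ) u
        - fiberIntegral f (fun l => (m + u ⬝ᵥ φ - u ⬝ᵥ l) ^ 2) q / 2|
      ≤ ε * (m ^ 2 + ‖u‖ ^ 2) + C * {u | η < ‖u‖}.indicator (fun u => ‖u‖ ^ 2) u := by
  set c : ℝ := 1 + n * ‖φ‖ with hc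
  have hc1 : 1 ≤ c := by rw [hc]; nlinarith [norm_nonneg φ, (Nat.cast_nonneg n : (0:ℝ) ≤ n)]
  have hz : ∀ (m : ℝ) (u : Fin n → ℝ), ‖(m + u ⬝ᵥ φ, u)‖ ≤ |m| + c * ‖u‖ := fun m u => by
    refine max_le ?_ ?_
    · calc |m + u ⬝ᵥ φ| ≤ |m| + |u ⬝ᵥ φ| := abs_add_le _ _
        _ ≤ |m| + n * (‖u‖ * ‖φ‖) := by gcongr; exact abs_dotProduct_le u φ
        _ ≤ _ := by rw [hc]; nlinarith [norm_nonneg u]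
    · show ‖u‖ ≤ _
      nlinarith [norm_nonneg u, abs_nonneg m]
  have ho := hf.isLittleO_kinkMean hn q
  rw [isLittleO_iff] at ho
  -- The factor `2 c²` undoes `(|m| + c ‖u‖)² ≤ 2 c² (m² + ‖u‖²)`.
  have hε1 : 0 < ε / (2 * c ^ 2) := by positivity
  obtain ⟨θ, hθ, hb⟩ := Metric.eventually_nhds_iff.1 (ho hε1)
  set A := ∫ l, (1 + n * ‖l‖) * f l
  set B := 2 * (1 + n ^ 2) * fiberIntegral f (fun l => 1 + ‖l‖ ^ 2) q
  have hA : 0 ≤ A := integral_nonneg fun l => mul_nonneg (by positivity) (hf.pos l).le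
  have hB : 0 ≤ B := mul_nonneg (by positivity)
    (integral_nonneg fun l => mul_nonneg (by positivity) (hf.pos _).le)
  -- With this choice `|m| + c ‖u‖ ≤ (1 + c) η = θ / 2` whenever `|m|, ‖u‖ ≤ η`.
  set η := θ / (2 * (1 + c)) with hη
  have hη0 : 0 < η := by positivity
  refine ⟨η, hη0, (1 + c) / η * A + (1 + c) ^ 2 * B, by positivity, fun m u hm => ?_⟩
  by_cases hu : η < ‖u‖
  · rw [Set.indicator_of_mem (by exact hu)]
    have hzu : ‖(m + u ⬝ᵥ φ, u)‖ ≤ (1 + c) * ‖u‖ := (hz m u).trans (by linarith)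
    have h1 := hf.kinkMean_le q (m + u ⬝ᵥ φ) u
    have h2 := hf.fiberIntegral_sq_le hn q (m + u ⬝ᵥ φ) u
    have hu2 : ‖u‖ ≤ ‖u‖ ^ 2 / η := by
      rw [le_div_iff₀ hη0]; nlinarith
    have h3 : |kinkMean f q (m + u ⬝ᵥ φ) u| ≤ ((1 + c) * (‖u‖ ^ 2 / η)) * A :=
      h1.trans (by gcongr; exact hzu.trans (by gcongr))
    have h4 : |fiberIntegral f (fun l => (m + u ⬝ᵥ φ - u ⬝ᵥ l) ^ 2) q|
        ≤ ((1 + c) * ‖u‖) ^ 2 * B := h2.trans (by gcongr)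
    have h5 := abs_nonneg (fiberIntegral f (fun l => (m + u ⬝ᵥ φ - u ⬝ᵥ l) ^ 2) q)
    have h6 := abs_sub (kinkMean f q (m + u ⬝ᵥ φ) u)
      (fiberIntegral f (fun l => (m + u ⬝ᵥ φ - u ⬝ᵥ l) ^ 2) q / 2)
    rw [abs_div, abs_two] at h6
    have h7 : 0 ≤ ε * (m ^ 2 + ‖u‖ ^ 2) := by positivity
    calc _ ≤ ((1 + c) * (‖u‖ ^ 2 / η)) * A + ((1 + c) * ‖u‖) ^ 2 * B := by linarith
      _ = ((1 + c) / η * A + (1 + c) ^ 2 * B) * ‖u‖ ^ 2 := by ring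
      _ ≤ _ := le_add_of_nonneg_left h7
  · rw [Set.indicator_of_notMem (by exact hu), mul_zero, add_zero]
    rw [not_lt] at hu
    have hlt : ‖(m + u ⬝ᵥ φ, u)‖ < θ := by
      calc ‖(m + u ⬝ᵥ φ, u)‖ ≤ η + c * η := (hz m u).trans (by gcongr)
        _ = θ / 2 := by rw [hη]; field_simp
        _ < θ := by linarith
    have h1 := hb (y := (m + u ⬝ᵥ φ, u)) (by rwa [dist_zero_right])
    rw [Real.norm_eq_abs, Real.norm_of_nonneg (sq_nonneg _)] at h1
    have h2 : ‖(m + u ⬝ᵥ φ, u)‖ ^ 2 ≤ 2 * c ^ 2 * (m ^ 2 + ‖u‖ ^ 2) := by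
      have h3 := pow_le_pow_left₀ (norm_nonneg _) (hz m u) 2
      have h4 : |m| ≤ c * |m| := le_mul_of_one_le_left (abs_nonneg m) hc1
      rw [← sq_abs m]
      nlinarith [sq_nonneg (|m| - c * ‖u‖), abs_nonneg m]
    calc _ ≤ ε / (2 * c ^ 2) * ‖(m + u ⬝ᵥ φ, u)‖ ^ 2 := h1
      _ ≤ ε / (2 * c ^ 2) * (2 * c ^ 2 * (m ^ 2 + ‖u‖ ^ 2)) := by gcongr
      _ = _ := by field_simp

end PointwiseBound

/-- In `w`, the kink is a convex positive part plus an affine function. -/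
lemma kink_convex (a w w' : ℝ) {t : ℝ} (h0 : 0 ≤ t) (h1 : t ≤ 1) :
    kink a (t * w + (1 - t) * w') ≤ t * kink a w + (1 - t) * kink a w' := by
  have hmax : max (a - (t * w + (1 - t) * w')) 0
      ≤ t * max (a - w) 0 + (1 - t) * max (a - w') 0 := by
    have h2 := le_max_left (a - w) 0
    have h3 := le_max_right (a - w) 0
    have h4 := le_max_left (a - w') 0
    have h5 := le_max_right (a - w') 0
    have h6 : 0 ≤ 1 - t := by linarith
    apply max_le
    · nlinarith [mul_le_mul_of_nonneg_left h2 h0, mul_le_mul_of_nonneg_left h4 h6]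
    · positivity
  unfold kink
  split_ifs <;> nlinarith

/-! ### First and second moments of the asset fluctuations. -/

section Assets

variable {Ω : Type*} [MeasurableSpace Ω] {P : Measure Ω} {n : ℕ} {L X : Ω → Fin n → ℝ}
  {f : (Fin n → ℝ) → ℝ}

/-- Square integrable random vectors with unit mean which are independent of `L`. -/
structure IsUnitMeanL2 (P : Measure Ω) (L X : Ω → Fin n → ℝ) : Prop where
  measurable : Measurable X
  indep : IndepFun X L P
  memLp : MemLp X 2 P
  mean_one : ∀ i, ∫ ω, X ω i ∂P = 1

lemma IsAssetVector.isUnitMeanL2 (hX : IsAssetVector P L X) (h2 : MemLp X 2 P) :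
    IsUnitMeanL2 P L X := ⟨hX.measurable, hX.indep, h2, hX.mean_one⟩

namespace IsUnitMeanL2

variable [IsProbabilityMeasure P] (hX : IsUnitMeanL2 P L X)
include hX

lemma memLp_sub_one (i : Fin n) : MemLp (fun ω => X ω i - 1) 2 P :=
  (memLp_pi_iff.1 hX.memLp i).sub (memLp_const 1)

lemma integrable_sub_one (i : Fin n) : Integrable (fun ω => X ω i - 1) P :=
  (hX.memLp_sub_one i).integrable (by norm_num)

lemma integral_sub_one (i : Fin n) : ∫ ω, (X ω i - 1) ∂P = 0 := by
  rw [integral_sub ((memLp_pi_iff.1 hX.memLp i).integrable (by norm_num)) (integrable_const 1),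
    hX.mean_one]
  simp

lemma integrable_mul_sub_one (i j : Fin n) :
    Integrable (fun ω => (X ω i - 1) * (X ω j - 1)) P :=
  (hX.memLp_sub_one i).integrable_mul (hX.memLp_sub_one j)

omit [IsProbabilityMeasure P] in
lemma integral_mul_sub_one (i j : Fin n) :
    ∫ ω, (X ω i - 1) * (X ω j - 1) ∂P = covMatrix P X i j := by
  simp [covMatrix, covariance, hX.mean_one]

lemma integrable_norm_sq : Integrable (fun ω => ‖X ω - 1‖ ^ 2) P :=
  (hX.memLp.sub (memLp_const 1)).integrable_norm_pow (by norm_num)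

lemma integral_sq_dotProduct (φ : Fin n → ℝ) :
    Integrable (fun ω => ((X ω - 1) ⬝ᵥ φ) ^ 2) P ∧
      ∫ ω, ((X ω - 1) ⬝ᵥ φ) ^ 2 ∂P = φ ⬝ᵥ covMatrix P X *ᵥ φ := by
  have heq : (fun ω => ((X ω - 1) ⬝ᵥ φ) ^ 2)
      = fun ω => ∑ i, ∑ j, (φ i * φ j) * ((X ω i - 1) * (X ω j - 1)) := by
    ext ω
    rw [sq, dotProduct, Finset.sum_mul_sum]
    exact Finset.sum_congr rfl fun i _ => Finset.sum_congr rfl fun j _ => by simp; ring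
  have hi := fun i j => (hX.integrable_mul_sub_one i j).const_mul (φ i * φ j)
  rw [heq]
  refine ⟨integrable_finsetSum _ fun i _ => integrable_finsetSum _ fun j _ => hi i j, ?_⟩
  rw [integral_finsetSum _ fun i _ => integrable_finsetSum _ fun j _ => hi i j]
  simp only [dotProduct, Matrix.mulVec, Finset.mul_sum]
  refine Finset.sum_congr rfl fun i _ => ?_
  rw [integral_finsetSum _ fun j _ => hi i j]
  refine Finset.sum_congr rfl fun j _ => ?_
  rw [integral_const_mul, hX.integral_mul_sub_one]; ring

lemma integral_dotProduct_mul (φ : Fin n → ℝ) (i : Fin n) :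
    Integrable (fun ω => ((X ω - 1) ⬝ᵥ φ) * (X ω i - 1)) P ∧
      ∫ ω, ((X ω - 1) ⬝ᵥ φ) * (X ω i - 1) ∂P = (covMatrix P X *ᵥ φ) i := by
  have heq : (fun ω => ((X ω - 1) ⬝ᵥ φ) * (X ω i - 1))
      = fun ω => ∑ j, φ j * ((X ω i - 1) * (X ω j - 1)) := by
    ext ω
    rw [dotProduct, Finset.sum_mul]
    exact Finset.sum_congr rfl fun j _ => by simp; ring
  have hi := fun j => (hX.integrable_mul_sub_one i j).const_mul (φ j)
  rw [heq]
  refine ⟨integrable_finsetSum _ fun j _ => hi j, ?_⟩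
  rw [integral_finsetSum _ fun j _ => hi j, Matrix.mulVec, dotProduct]
  refine Finset.sum_congr rfl fun j _ => ?_
  rw [integral_const_mul, hX.integral_mul_sub_one]; ring

lemma integral_dotProduct (φ : Fin n → ℝ) :
    Integrable (fun ω => (X ω - 1) ⬝ᵥ φ) P ∧ ∫ ω, (X ω - 1) ⬝ᵥ φ ∂P = 0 := by
  have hi := fun i => (hX.integrable_sub_one i).mul_const (φ i)
  have heq : (fun ω => (X ω - 1) ⬝ᵥ φ) = fun ω => ∑ i, (X ω i - 1) * φ i := rfl
  rw [heq]
  refine ⟨integrable_finsetSum _ fun i _ => hi i, ?_⟩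
  rw [integral_finsetSum _ fun i _ => hi i]
  simp [integral_mul_const, hX.integral_sub_one]

/-- The terms linear in `m` vanish because `X - 1` is centred. What remains beside `m²` is the
expression found for `-K[φ - L]'(q)` in `hasDerivAt_KQuad_sub`. -/
lemma integral_fiberIntegral_sq (hf : IsTameDensity f) (hn : 0 < n) (q m : ℝ) (φ : Fin n → ℝ) :
    Integrable (fun ω => fiberIntegral f
      (fun l => (m + (X ω - 1) ⬝ᵥ φ - (X ω - 1) ⬝ᵥ l) ^ 2) q) P ∧
    ∫ ω, fiberIntegral f (fun l => (m + (X ω - 1) ⬝ᵥ φ - (X ω - 1) ⬝ᵥ l) ^ 2) q ∂P =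
      m ^ 2 * fiberIntegral f 1 q + ((φ ⬝ᵥ covMatrix P X *ᵥ φ) * fiberIntegral f 1 q
        - 2 * ∑ i, (covMatrix P X *ᵥ φ) i * fiberIntegral f (fun l => l i) q
        + ∑ i, ∑ j, covMatrix P X i j * fiberIntegral f (fun l => l i * l j) q) := by
  have h0 := hX.integral_dotProduct φ
  have h1 := hX.integral_sq_dotProduct φ
  have h2 := hX.integral_dotProduct_mul φ
  set d0 := fiberIntegral f 1 q
  set d1 := fun i => fiberIntegral f (fun l => l i) q with hd1
  set d2 := fun i j => fiberIntegral f (fun l => l i * l j) q with hd2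
  have ha : Integrable (fun ω => (m + (X ω - 1) ⬝ᵥ φ) ^ 2) P ∧
      ∫ ω, (m + (X ω - 1) ⬝ᵥ φ) ^ 2 ∂P = m ^ 2 + φ ⬝ᵥ covMatrix P X *ᵥ φ := by
    have heq : (fun ω => (m + (X ω - 1) ⬝ᵥ φ) ^ 2)
        = fun ω => m ^ 2 + 2 * m * ((X ω - 1) ⬝ᵥ φ) + ((X ω - 1) ⬝ᵥ φ) ^ 2 := by ext ω; ring
    have hi : Integrable (fun ω => m ^ 2 + 2 * m * ((X ω - 1) ⬝ᵥ φ)) P :=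
      (integrable_const _).add (h0.1.const_mul _)
    rw [heq]
    refine ⟨hi.add h1.1, ?_⟩
    rw [integral_add hi h1.1, integral_add (integrable_const _) (h0.1.const_mul _),
      integral_const_mul, h0.2, h1.2]
    simp
  have hb : ∀ i, Integrable (fun ω => (m + (X ω - 1) ⬝ᵥ φ) * (X ω i - 1)) P ∧
      ∫ ω, (m + (X ω - 1) ⬝ᵥ φ) * (X ω i - 1) ∂P = (covMatrix P X *ᵥ φ) i := fun i => by
    have hi := (hX.integrable_sub_one i).const_mul m
    simp only [add_mul]
    refine ⟨hi.add (h2 i).1, ?_⟩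
    rw [integral_add hi (h2 i).1, integral_const_mul, hX.integral_sub_one, (h2 i).2]
    simp
  have heq : (fun ω => fiberIntegral f
      (fun l => (m + (X ω - 1) ⬝ᵥ φ - (X ω - 1) ⬝ᵥ l) ^ 2) q)
      = fun ω => (m + (X ω - 1) ⬝ᵥ φ) ^ 2 * d0
        + ∑ i, (-2 * d1 i) * ((m + (X ω - 1) ⬝ᵥ φ) * (X ω i - 1))
        + ∑ i, ∑ j, d2 i j * ((X ω i - 1) * (X ω j - 1)) := by
    ext ω
    rw [sq_sub_dotProduct_eq_quadPoly, hf.fiberIntegral_quadPoly hn]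
    congr 2
    · refine Finset.sum_congr rfl fun i _ => ?_
      simp only [hd1, Pi.smul_apply, Pi.sub_apply, Pi.one_apply, smul_eq_mul]; ring
    · ext i
      refine Finset.sum_congr rfl fun j _ => ?_
      simp only [hd2, Matrix.vecMulVec_apply, Pi.sub_apply, Pi.one_apply]; ring
  have hi0 := ha.1.mul_const d0
  have hi1 := fun i => (hb i).1.const_mul (-2 * d1 i)
  have hi2 := fun i j => (hX.integrable_mul_sub_one i j).const_mul (d2 i j)
  have hs1 := integrable_finsetSum Finset.univ fun i _ => hi1 i
  have hs2 := integrable_finsetSum Finset.univ fun i _ =>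
    integrable_finsetSum Finset.univ fun j _ => hi2 i j
  rw [heq]
  refine ⟨(hi0.add hs1).add hs2, ?_⟩
  have e1 := integral_add (hi0.add hs1) hs2
  simp only [Pi.add_apply] at e1
  rw [e1, integral_add hi0 hs1, integral_mul_const, ha.2,
    integral_finsetSum _ fun i _ => hi1 i,
    integral_finsetSum _ fun i _ => integrable_finsetSum Finset.univ fun j _ => hi2 i j]
  simp only [integral_finsetSum Finset.univ fun j _ => hi2 _ j, integral_const_mul,
    hX.integral_mul_sub_one, (hb _).2]
  rw [Finset.mul_sum, add_mul, add_assoc, add_assoc, sub_eq_add_neg, ← Finset.sum_neg_distrib,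
    add_assoc]
  congr 3
  · exact Finset.sum_congr rfl fun i _ => by ring
  · exact Finset.sum_congr rfl fun i _ => Finset.sum_congr rfl fun j _ => mul_comm _ _

end IsUnitMeanL2

end Assets

/-! ### Exact reduction of the expected shortfall to the mean kink. -/

section KinkRisk

lemma measurable_kink_surplus {n : ℕ} (φ : Fin n → ℝ) (q m : ℝ) :
    Measurable fun z : (Fin n → ℝ) × (Fin n → ℝ) =>
      kink (1 ⬝ᵥ z.2 - q) (m + (z.1 - 1) ⬝ᵥ (φ - z.2)) := by
  refine measurable_kink.comp (Measurable.prodMk ?_ ?_)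
  · exact (continuous_one_dotProduct.measurable.comp measurable_snd).sub_const q
  · unfold dotProduct
    fun_prop

lemma surplus_eq {Ω : Type*} {n : ℕ} (X L : Ω → Fin n → ℝ) (φ : Fin n → ℝ) (ω : Ω) :
    surplus X L φ ω = -(1 ⬝ᵥ L ω) + (X ω - 1) ⬝ᵥ (φ - L ω) := by
  rw [surplus, dotProduct_sub, sub_dotProduct _ _ (L ω)]; ring

lemma measurable_surplus {Ω : Type*} [MeasurableSpace Ω] {n : ℕ} {X L : Ω → Fin n → ℝ}
    (hL : Measurable L) (hX : Measurable X) (φ : Fin n → ℝ) : Measurable (surplus X L φ) := by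
  unfold surplus dotProduct
  fun_prop

variable {Ω : Type*} [MeasurableSpace Ω] {P : Measure Ω} {n : ℕ} {L X : Ω → Fin n → ℝ}
  {f : (Fin n → ℝ) → ℝ}

/-- The excess of the Rockafellar-Uryasev functional of the surplus at `q + m` over its value for
`-⟨1, L⟩` at `q`. -/
noncomputable def kinkRisk (P : Measure Ω) (L X : Ω → Fin n → ℝ) (φ : Fin n → ℝ) (q m : ℝ) : ℝ :=
  ∫ ω, kink (1 ⬝ᵥ L ω - q) (m + (X ω - 1) ⬝ᵥ (φ - L ω)) ∂P

variable [IsProbabilityMeasure P] (h : HasTameDensity P L f) (hX : IsUnitMeanL2 P L X)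
  (φ : Fin n → ℝ)
include h hX

lemma integrable_dotProduct_sub : Integrable (fun ω => (X ω - 1) ⬝ᵥ (φ - L ω)) P := by
  have heq : (fun ω => (X ω - 1) ⬝ᵥ (φ - L ω))
      = fun ω => ∑ i, (X ω i - 1) * (φ i - L ω i) := rfl
  rw [heq]
  refine integrable_finsetSum _ fun i _ => ?_
  have hind : IndepFun (fun ω => X ω i - 1) (fun ω => φ i - L ω i) P :=
    hX.indep.comp (φ := fun x : Fin n → ℝ => x i - 1) (ψ := fun l : Fin n → ℝ => φ i - l i) (by fun_prop) (by fun_prop)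
  exact hind.integrable_mul (hX.integrable_sub_one i)
    ((integrable_const _).sub (h.integrable_comp (quadGrowth_coord i)))

/-- Each summand is a centred function of `X` times a function of `L`, so independence kills the
first order effect of the assets. -/
lemma integral_indicator_dotProduct_sub (q : ℝ) :
    ∫ ω, {ω | q < 1 ⬝ᵥ L ω}.indicator (fun ω => (X ω - 1) ⬝ᵥ (φ - L ω)) ω ∂P = 0 := by
  have hms : MeasurableSet {l : Fin n → ℝ | q < 1 ⬝ᵥ l} :=
    measurableSet_lt measurable_const continuous_one_dotProduct.measurable
  have hmsΩ : MeasurableSet {ω | q < 1 ⬝ᵥ L ω} := h.measurable hms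
  set ψ : Fin n → (Fin n → ℝ) → ℝ := fun i => {l | q < 1 ⬝ᵥ l}.indicator fun l => φ i - l i
  have hψ : ∀ i, Measurable (ψ i) := fun i => Measurable.indicator (by fun_prop) hms
  have heq : (fun ω => {ω | q < 1 ⬝ᵥ L ω}.indicator (fun ω => (X ω - 1) ⬝ᵥ (φ - L ω)) ω)
      = fun ω => ∑ i, (X ω i - 1) * ψ i (L ω) := by
    ext ω
    by_cases hω : q < 1 ⬝ᵥ L ω
    · rw [Set.indicator_of_mem (by exact hω)]
      refine Finset.sum_congr rfl fun i _ => ?_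
      simp only [ψ]
      rw [Set.indicator_of_mem (by exact hω)]; rfl
    · rw [Set.indicator_of_notMem (by exact hω)]
      refine (Finset.sum_eq_zero fun i _ => ?_).symm
      simp only [ψ]
      rw [Set.indicator_of_notMem (by exact hω), mul_zero]
  have hind : ∀ i, IndepFun (fun ω => X ω i - 1) (fun ω => ψ i (L ω)) P := fun i =>
    hX.indep.comp (φ := fun x : Fin n → ℝ => x i - 1) (ψ := ψ i) (by fun_prop) (hψ i)
  have hiψ : ∀ i, Integrable (fun ω => ψ i (L ω)) P := fun i =>
    (((integrable_const (φ i)).sub (h.integrable_comp (quadGrowth_coord i))).indicator hmsΩ)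
  have hprod : ∀ i, Integrable (fun ω => (X ω i - 1) * ψ i (L ω)) P := fun i =>
    (hind i).integrable_mul (hX.integrable_sub_one i) (hiψ i)
  rw [heq, integral_finsetSum _ fun i _ => hprod i]
  refine Finset.sum_eq_zero fun i _ => ?_
  rw [(hind i).integral_fun_mul_eq_mul_integral (hX.integrable_sub_one i).aestronglyMeasurable
    (hiψ i).aestronglyMeasurable, hX.integral_sub_one, zero_mul]

lemma integrable_kink_surplus (q m : ℝ) :
    Integrable (fun ω => kink (1 ⬝ᵥ L ω - q) (m + (X ω - 1) ⬝ᵥ (φ - L ω))) P := by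
  have hi := (integrable_const (μ := P) m).add (integrable_dotProduct_sub h hX φ)
  refine hi.abs.mono' ?_ (Eventually.of_forall fun ω => ?_)
  · exact ((measurable_kink_surplus φ q m).comp
      (hX.measurable.prodMk h.measurable)).aestronglyMeasurable
  · rw [Real.norm_of_nonneg (kink_nonneg _ _)]
    exact kink_le_abs _ _

/-- Fubini under the product law of `(X, L)`: the inner integral over `L` freezes the fluctuation `X
- 1`. -/
lemma kinkRisk_eq_integral_kinkMean (q m : ℝ) :
    Integrable (fun ω => kinkMean f q (m + (X ω - 1) ⬝ᵥ φ) (X ω - 1)) P ∧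
    kinkRisk P L X φ q m = ∫ ω, kinkMean f q (m + (X ω - 1) ⬝ᵥ φ) (X ω - 1) ∂P := by
  set F : (Fin n → ℝ) × (Fin n → ℝ) → ℝ := fun z =>
    kink (1 ⬝ᵥ z.2 - q) (m + (z.1 - 1) ⬝ᵥ (φ - z.2)) with hF
  have hFm : Measurable F := measurable_kink_surplus φ q m
  have hXL := hX.measurable.prodMk h.measurable
  have hmap := (indepFun_iff_map_prod_eq_prod_map_map hX.measurable.aemeasurable
    h.measurable.aemeasurable).1 hX.indep
  have hi := (integrable_map_measure hFm.aestronglyMeasurable hXL.aemeasurable).2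
    (integrable_kink_surplus h hX φ q m)
  rw [hmap] at hi
  have hinner : (fun x => ∫ l, F (x, l) ∂P.map L)
      = fun x => kinkMean f q (m + (x - 1) ⬝ᵥ φ) (x - 1) := by
    ext x
    rw [h.integral_map_eq, kinkMean]
    simp only [hF, dotProduct_sub, add_sub_assoc]
  have hi2 := hi.integral_prod_left
  rw [hinner] at hi2
  refine ⟨(integrable_map_measure hi2.1 hX.measurable.aemeasurable).1 hi2, ?_⟩
  have h1 : kinkRisk P L X φ q m = ∫ z, F z ∂P.map fun ω => (X ω, L ω) :=
    (integral_map hXL.aemeasurable hFm.aestronglyMeasurable).symm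
  rw [h1, hmap, integral_prod _ hi, hinner, integral_map hX.measurable.aemeasurable hi2.1]

/-- Serves to confine the minimising `m` to the range where the expansion is valid. -/
lemma kinkRisk_convex (q m : ℝ) {t : ℝ} (h0 : 0 ≤ t) (h1 : t ≤ 1) :
    kinkRisk P L X φ q (t * m) ≤ t * kinkRisk P L X φ q m + (1 - t) * kinkRisk P L X φ q 0 := by
  have hi := integrable_kink_surplus h hX φ q
  unfold kinkRisk
  rw [← integral_const_mul, ← integral_const_mul,
    ← integral_add ((hi m).const_mul _) ((hi 0).const_mul _)]
  refine integral_mono (hi _) (((hi m).const_mul _).add ((hi 0).const_mul _)) fun ω => ?_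
  refine le_trans (le_of_eq ?_) (kink_convex _ _ _ h0 h1)
  congr 1; ring

lemma integrable_surplus : Integrable (surplus X L φ) P := by
  refine (h.integrable_total.neg.add (integrable_dotProduct_sub h hX φ)).congr
    (Eventually.of_forall fun ω => ?_)
  rw [surplus_eq]; rfl

variable {α : ℝ} (hα : α ∈ Set.Ioo (0 : ℝ) 1)
include hα

/-- Integrates the pointwise decomposition of `(a - w)⁺`. The zeroth order part is `mul_ES_eq` for
`-⟨1, L⟩`, and the first order part equals `α m` and cancels. -/
lemma kinkRisk_eq (m : ℝ) : α * (aggQuantile P L α + m)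
      + ∫ ω, max (-surplus X L φ ω - (aggQuantile P L α + m)) 0 ∂P
    = α * ES P α (fun ω => -(1 ⬝ᵥ L ω)) + kinkRisk P L X φ (aggQuantile P L α) m := by
  set q := aggQuantile P L α with hq
  have hM := h.integrable_total
  have hneg : Measurable fun ω => -(1 ⬝ᵥ L ω) := h.measurable_total.neg
  have hW := integrable_dotProduct_sub h hX φ
  have hmsΩ : MeasurableSet {ω | q < 1 ⬝ᵥ L ω} :=
    measurableSet_lt measurable_const h.measurable_total
  have h1 := mul_ES_eq (P := P) hα hneg hM.neg
  simp only [neg_neg] at h1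
  have hqV : (VaR P α fun ω => -(1 ⬝ᵥ L ω)) = q := rfl
  rw [hqV] at h1
  have hpt : ∀ ω, kink (1 ⬝ᵥ L ω - q) (m + (X ω - 1) ⬝ᵥ (φ - L ω))
      = max (-surplus X L φ ω - (q + m)) 0 - max (1 ⬝ᵥ L ω - q) 0
        + (m * {ω | q < 1 ⬝ᵥ L ω}.indicator 1 ω
        + {ω | q < 1 ⬝ᵥ L ω}.indicator (fun ω => (X ω - 1) ⬝ᵥ (φ - L ω)) ω) := fun ω => by
    rw [kink, surplus_eq]
    congr 1
    · congr 2; ring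
    · by_cases hω : q < 1 ⬝ᵥ L ω
      · rw [Set.indicator_of_mem (by exact hω), Set.indicator_of_mem (by exact hω),
          if_pos (by linarith)]
        simp
      · rw [Set.indicator_of_notMem (by exact hω), Set.indicator_of_notMem (by exact hω),
          if_neg (by linarith)]
        simp
  have i1 : Integrable (fun ω => max (-surplus X L φ ω - (q + m)) 0) P := by
    refine Integrable.pos_part (((hM.sub hW).sub (integrable_const (q + m))).congr
      (Eventually.of_forall fun ω => ?_))
    simp only [Pi.sub_apply]
    rw [surplus_eq]; ring
  have i2 : Integrable (fun ω => max (1 ⬝ᵥ L ω - q) 0) P :=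
    (hM.sub (integrable_const q)).pos_part
  have i3 : Integrable (fun ω => m * {ω | q < 1 ⬝ᵥ L ω}.indicator (1 : Ω → ℝ) ω) P :=
    ((integrable_const (1 : ℝ)).indicator hmsΩ).const_mul m
  have i4 := hW.indicator hmsΩ
  have hprob : ∫ ω, {ω | q < 1 ⬝ᵥ L ω}.indicator (1 : Ω → ℝ) ω ∂P = α := by
    have h3 := integral_indicator_one (μ := P) hmsΩ
    rw [h3, hq, h.real_aggQuantile_lt hα]
  have e1 := integral_add (i1.sub i2) (i3.add i4)
  simp only [Pi.sub_apply, Pi.add_apply] at e1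
  rw [h1, kinkRisk, integral_congr_ae (Eventually.of_forall hpt), e1, integral_sub i1 i2,
    integral_add i3 i4, integral_const_mul, hprob, integral_indicator_dotProduct_sub h hX]
  ring

lemma mul_ES_surplus_le (m : ℝ) : α * ES P α (surplus X L φ)
    ≤ α * ES P α (fun ω => -(1 ⬝ᵥ L ω)) + kinkRisk P L X φ (aggQuantile P L α) m := by
  rw [← kinkRisk_eq h hX φ hα m]
  exact mul_ES_le hα (measurable_surplus h.measurable hX.measurable φ) (integrable_surplus h hX φ) _

lemma exists_mul_ES_surplus_eq : ∃ m, α * ES P α (surplus X L φ)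
    = α * ES P α (fun ω => -(1 ⬝ᵥ L ω)) + kinkRisk P L X φ (aggQuantile P L α) m := by
  refine ⟨VaR P α (surplus X L φ) - aggQuantile P L α, ?_⟩
  rw [← kinkRisk_eq h hX φ hα, add_sub_cancel]
  exact mul_ES_eq hα (measurable_surplus h.measurable hX.measurable φ) (integrable_surplus h hX φ)

end KinkRisk

/-! ### Second order expansion for general families of assets. -/

section Expansion

variable {Ω : Type*} [MeasurableSpace Ω] {P : Measure Ω} {n : ℕ} {L : Ω → Fin n → ℝ}
  {f : (Fin n → ℝ) → ℝ}

/-- The mean square of `X - 1` on the event that `X - 1` has norm larger than `η`. -/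
noncomputable def tailSq (P : Measure Ω) (X : Ω → Fin n → ℝ) (η : ℝ) : ℝ :=
  ∫ ω, {u : Fin n → ℝ | η < ‖u‖}.indicator (fun u => ‖u‖ ^ 2) (X ω - 1) ∂P

variable [IsProbabilityMeasure P] (h : HasTameDensity P L f)
include h

/-- The point is that `η` and `C` are chosen before `X`, so the bound applies along a whole family.
-/
lemma exists_kinkRisk_bound (q : ℝ) (φ : Fin n → ℝ) {ε : ℝ} (hε : 0 < ε) :
    ∃ η > 0, ∃ C ≥ 0, ∀ (X : Ω → Fin n → ℝ), IsUnitMeanL2 P L X → ∀ m, |m| ≤ η →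
      |kinkRisk P L X φ q m
        - (m ^ 2 * aggDensity P L q - deriv (KQuad P L X fun ω => φ - L ω) q) / 2|
      ≤ ε * (m ^ 2 + ∫ ω, ‖X ω - 1‖ ^ 2 ∂P) + C * tailSq P X η := by
  obtain ⟨η, hη, C, hC, hb⟩ := h.tame.exists_kinkMean_bound h.n_pos q φ hε
  refine ⟨η, hη, C, hC, fun X hX m hm => ?_⟩
  have hA := kinkRisk_eq_integral_kinkMean h hX φ q m
  have hQ := hX.integral_fiberIntegral_sq h.tame h.n_pos q m φ
  have hs := hX.integrable_norm_sq
  have hms : MeasurableSet {u : Fin n → ℝ | η < ‖u‖} :=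
    measurableSet_lt measurable_const measurable_norm
  have ht : Integrable (fun ω => {u : Fin n → ℝ | η < ‖u‖}.indicator (fun u => ‖u‖ ^ 2)
      (X ω - 1)) P :=
    hs.indicator (s := {ω | η < ‖X ω - 1‖}) (hX.measurable.sub_const 1 hms)
  have hdi := hA.1.sub (hQ.1.div_const 2)
  have i1 : Integrable (fun ω => ε * (m ^ 2 + ‖X ω - 1‖ ^ 2)) P :=
    ((integrable_const _).add hs).const_mul ε
  have hfin : ∫ ω, (ε * (m ^ 2 + ‖X ω - 1‖ ^ 2) + C * {u : Fin n → ℝ | η < ‖u‖}.indicator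
      (fun u => ‖u‖ ^ 2) (X ω - 1)) ∂P
      = ε * (m ^ 2 + ∫ ω, ‖X ω - 1‖ ^ 2 ∂P) + C * tailSq P X η := by
    rw [integral_add i1 (ht.const_mul C), integral_const_mul, integral_const_mul,
      integral_add (integrable_const _) hs]
    simp [tailSq]
  have hderiv := (h.hasDerivAt_KQuad_sub X φ q).deriv
  rw [← hfin, hA.2, hderiv, h.aggDensity_eq, sub_neg_eq_add, ← hQ.2, ← integral_div,
    ← integral_sub hA.1 (hQ.1.div_const 2), ← Real.norm_eq_abs]
  exact norm_integral_le_of_norm_le (i1.add (ht.const_mul C))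
    (Eventually.of_forall fun ω => hb m (X ω - 1) hm)

/-- The second order expansion of the expected shortfall of the surplus. -/
theorem isLittleO_ES_sub_esExpansion {α : ℝ} (hα : α ∈ Set.Ioo (0 : ℝ) 1) {ι : Type*}
    {l : Filter ι} {X : ι → Ω → Fin n → ℝ} {σ : ι → ℝ} (hX : ∀ᶠ t in l, IsUnitMeanL2 P L (X t))
    (hσ : Tendsto σ l (𝓝 0)) {C : ℝ} (hC : ∀ᶠ t in l, ∫ ω, ‖X t ω - 1‖ ^ 2 ∂P ≤ C * σ t ^ 2)
    (htail : ∀ η > 0, (fun t => tailSq P (X t) η) =o[l] fun t => σ t ^ 2) (φ : Fin n → ℝ) :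
    (fun t => ES P α (surplus (X t) L φ) - esExpansion P α L (X t) φ) =o[l] fun t => σ t ^ 2 := by
  set q := aggQuantile P L α with hq
  set d := aggDensity P L q with hd
  have hdpos : 0 < d := by rw [hd, h.aggDensity_eq]; exact h.tame.fiberIntegral_one_pos h.n_pos q
  rw [← isLittleO_const_mul_left_iff hα.1.ne', isLittleO_iff]
  intro ε' hε'
  -- The first bound leaves the `m²` coefficient `d / 2 - ε` at least `d / 4`; the second makes `ε`
  -- times the mean square at most half of `ε' σ²`. The tail term takes the other half.
  set ε := min (d / 4) (ε' / (2 * (|C| + 1))) with hεdef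
  have hε : 0 < ε := by positivity
  obtain ⟨η, hη, D, hD, hbd⟩ := exists_kinkRisk_bound h q φ hε
  have hev := (htail η hη).def (show 0 < ε' / (2 * (D + 1)) by positivity)
  have hσ2 : Tendsto (fun t => 2 * (ε' * σ t ^ 2)) l (𝓝 0) := by
    simpa using ((hσ.pow 2).const_mul ε').const_mul 2
  filter_upwards [hX, hC, hev, hσ2.eventually (gt_mem_nhds (show 0 < d / 4 * η ^ 2 by positivity))]
    with t hXt hCt hTt hσt
  set A := kinkRisk P L (X t) φ q with hA
  set κ := -deriv (KQuad P L (X t) fun ω => φ - L ω) q with hκ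
  set E := ∫ ω, ‖X t ω - 1‖ ^ 2 ∂P with hE
  set T := tailSq P (X t) η
  have hE0 : 0 ≤ E := integral_nonneg fun ω => sq_nonneg _
  rw [Real.norm_eq_abs, Real.norm_of_nonneg (sq_nonneg _)] at hTt
  have herr : ε * E + D * T ≤ ε' * σ t ^ 2 := by
    have e1 : ε * E ≤ ε' / 2 * σ t ^ 2 := by
      calc ε * E ≤ ε' / (2 * (|C| + 1)) * ((|C| + 1) * σ t ^ 2) := by
            gcongr
            · exact min_le_right _ _
            · refine hCt.trans ?_
              gcongr
              linarith [le_abs_self C]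
        _ = _ := by field_simp
    have e2 : D * T ≤ ε' / 2 * σ t ^ 2 := by
      calc D * T ≤ (D + 1) * (ε' / (2 * (D + 1)) * σ t ^ 2) := by
            have h3 := (le_abs_self T).trans hTt
            nlinarith [abs_nonneg T, mul_le_mul_of_nonneg_left h3 hD]
        _ = _ := by field_simp
    linarith
  have hεd : ε ≤ d / 4 := min_le_left _ _
  have hb := fun m hm => abs_le.1 (hbd (X t) hXt m hm)
  have key : ∀ m, |m| ≤ η → A m ≤ m ^ 2 * d / 2 + κ / 2 + ε * m ^ 2 + ε' * σ t ^ 2 ∧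
      m ^ 2 * d / 2 + κ / 2 - ε * m ^ 2 - ε' * σ t ^ 2 ≤ A m := fun m hm => by
    obtain ⟨b1, b2⟩ := hb m hm
    constructor <;> linarith
  have hB : α * (ES P α (surplus (X t) L φ) - esExpansion P α L (X t) φ)
      = α * ES P α (surplus (X t) L φ) - α * ES P α (fun ω => -(1 ⬝ᵥ L ω)) - κ / 2 := by
    have hα0 := hα.1.ne'
    rw [esExpansion, ← hq, hκ]
    field_simp
    ring
  have hup := mul_ES_surplus_le h hXt φ hα 0
  obtain ⟨m, hm⟩ := exists_mul_ES_surplus_eq h hXt φ hα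
  have hA0 := key 0 (by simpa using hη.le)
  rw [← hq, ← hA] at hup hm
  rw [hB, Real.norm_eq_abs, Real.norm_of_nonneg (sq_nonneg _), abs_le]
  refine ⟨?_, by linarith [hA0.1]⟩
  -- If the minimiser were farther out, convexity would give a point at distance `η` where `A` is at
  -- most `A 0`. But there `A` exceeds `A 0` by at least `d / 4 * η² - 2 ε' σ²`, which is positive.
  have hmη : |m| ≤ η := by
    by_contra! hcon
    have hmpos : 0 < |m| := hη.trans hcon
    have ht0 : 0 < η / |m| := by positivity
    have ht1 : η / |m| ≤ 1 := (div_le_one hmpos).2 hcon.le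
    have hconv := kinkRisk_convex h hXt φ q m ht0.le ht1
    have hAm : A m ≤ A 0 := by linarith
    have habs : |η / |m| * m| = η := by
      rw [abs_mul, abs_div, abs_abs, abs_of_pos hη, div_mul_cancel₀ _ hmpos.ne']
    have hk := (key (η / |m| * m) habs.le).2
    have hsq : (η / |m| * m) ^ 2 = η ^ 2 := by rw [← sq_abs, habs]
    rw [hsq] at hk
    rw [← hA] at hconv
    nlinarith [hA0.1, mul_le_mul_of_nonneg_left hAm ht0.le,
      mul_le_mul_of_nonneg_right hεd (sq_nonneg η)]
  have hk := (key m hmη).2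
  -- The net `m²` term is nonnegative and can be dropped from the lower bound.
  nlinarith [mul_le_mul_of_nonneg_right hεd (sq_nonneg m), mul_nonneg hdpos.le (sq_nonneg m)]

end Expansion

/-! ### Dominated families and rescaling of the normal volatility. -/

section Situations

variable {Ω : Type*} [MeasurableSpace Ω] {P : Measure Ω} [IsProbabilityMeasure P] {n : ℕ}
  {L : Ω → Fin n → ℝ} {f : (Fin n → ℝ) → ℝ}

lemma measurableSet_lt_norm_sub_one {X : Ω → Fin n → ℝ} (hX : Measurable X) (η : ℝ) :
    MeasurableSet {ω | η < ‖X ω - 1‖} :=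
  measurableSet_lt measurable_const (hX.sub_const 1).norm

/-- At each `ω` the event `‖X t - 1‖ > η` eventually fails since `|σ t| * G ω → 0`; dominated
convergence with `G²` handles the tail. -/
lemma isLittleO_ES_of_dominated (h : HasTameDensity P L f) {α : ℝ} (hα : α ∈ Set.Ioo (0 : ℝ) 1)
    {ι : Type*} {l : Filter ι} [l.IsCountablyGenerated] {X : ι → Ω → Fin n → ℝ} {σ : ι → ℝ}
    (hX : ∀ᶠ t in l, IsUnitMeanL2 P L (X t)) (hσ : Tendsto σ l (𝓝 0)) {G : Ω → ℝ}
    (hG : MemLp G 2 P) (hb : ∀ᶠ t in l, ∀ ω, ‖X t ω - 1‖ ≤ |σ t| * G ω) (φ : Fin n → ℝ) :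
    (fun t => ES P α (surplus (X t) L φ) - esExpansion P α L (X t) φ) =o[l] fun t => σ t ^ 2 := by
  have hG2 := hG.integrable_sq
  have hsq : ∀ᶠ t in l, ∀ ω, ‖X t ω - 1‖ ^ 2 ≤ G ω ^ 2 * σ t ^ 2 := by
    filter_upwards [hb] with t ht ω
    rw [← sq_abs (σ t), mul_comm, ← mul_pow]
    exact pow_le_pow_left₀ (norm_nonneg _) (ht ω) 2
  refine isLittleO_ES_sub_esExpansion h hα hX hσ (C := ∫ ω, G ω ^ 2 ∂P) ?_ (fun η hη => ?_) φ
  · filter_upwards [hX, hsq] with t hXt ht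
    rw [← integral_mul_const]
    exact integral_mono hXt.integrable_norm_sq (hG2.mul_const _) ht
  · refine isLittleO_integral_of_dominated ?_ ?_ hG2 fun ω => ?_
    · filter_upwards [hX] with t hXt
      exact (hXt.integrable_norm_sq.indicator
        (measurableSet_lt_norm_sub_one hXt.measurable η)).aestronglyMeasurable
    · filter_upwards [hsq] with t ht ω
      rw [abs_of_nonneg (sq_nonneg (σ t)),
        abs_of_nonneg (Set.indicator_nonneg (fun _ _ => sq_nonneg _) _)]
      exact (Set.indicator_le_self' (fun _ _ => sq_nonneg _) _).trans (ht ω)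
    · refine (isLittleO_zero (E' := ℝ) (fun t => σ t ^ 2) l).congr' ?_ EventuallyEq.rfl
      have h0 : Tendsto (fun t => |σ t| * G ω) l (𝓝 0) := by
        simpa using hσ.abs.mul_const (G ω)
      filter_upwards [hb, h0.eventually (gt_mem_nhds hη)] with t ht hlt
      rw [Set.indicator_of_notMem]
      exact not_lt.2 ((ht ω).trans hlt.le)

lemma isLittleO_ES_normalScaling (h : HasTameDensity P L f) {α : ℝ} (hα : α ∈ Set.Ioo (0 : ℝ) 1)
    {X : Ω → Fin n → ℝ} (hX : IsUnitMeanL2 P L X) (φ : Fin n → ℝ) :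
    (fun σ : ℝ => ES P α (surplus (normalScaling P X σ) L φ)
      - esExpansion P α L (normalScaling P X σ) φ) =o[𝓝[>] 0] fun σ => σ ^ 2 := by
  set v := normalVol P X with hv
  have hsub : ∀ σ ω, normalScaling P X σ ω - 1 = (σ * v⁻¹) • (X ω - 1) := fun σ ω => by
    ext i
    simp only [normalScaling, Pi.sub_apply, Pi.one_apply, Pi.smul_apply, smul_eq_mul, ← hv]
    ring
  have heq : ∀ σ, normalScaling P X σ = (fun x => 1 + (σ * v⁻¹) • (x - 1)) ∘ X := fun σ => by
    ext1 ω
    rw [Function.comp_apply, ← hsub, add_sub_cancel]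
  have hm : ∀ σ : ℝ, Measurable fun x : Fin n → ℝ => 1 + (σ * v⁻¹) • (x - 1) := fun σ => by
    fun_prop
  have hmem : MemLp (fun ω => X ω - 1) 2 P := hX.memLp.sub (memLp_const 1)
  refine isLittleO_ES_of_dominated h hα (Eventually.of_forall fun σ => ?_)
    (tendsto_nhdsWithin_of_tendsto_nhds tendsto_id) (G := fun ω => |v⁻¹| * ‖X ω - 1‖)
    (hmem.norm.const_mul _) (Eventually.of_forall fun σ ω => ?_) φ
  · refine ⟨?_, ?_, ?_, fun i => ?_⟩
    · rw [heq]; exact (hm σ).comp hX.measurable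
    · rw [heq]; exact hX.indep.comp (hm σ) measurable_id
    · rw [heq]
      have h1 := (memLp_const (1 : Fin n → ℝ)).add (hmem.const_smul (σ * v⁻¹))
      exact h1
    · simp only [normalScaling]
      rw [integral_add (integrable_const _) (((hX.integrable_sub_one i).div_const _).const_mul σ),
        integral_const_mul, integral_div, hX.integral_sub_one]
      simp
  · rw [hsub, norm_smul, Real.norm_eq_abs, abs_mul, mul_assoc]; rfl

end Situations

/-! ### Rescaling of the log-normal volatility. -/

section LogScaling

variable {Ω : Type*} [MeasurableSpace Ω] {P : Measure Ω} [IsProbabilityMeasure P] {n : ℕ}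
  {L X : Ω → Fin n → ℝ} {f : (Fin n → ℝ) → ℝ}

/-- For `x > 0`, `exp |log x|` is the larger of `x` and `x⁻¹`, hence at most their sum. -/
lemma IsAssetVector.integrable_exp_abs_log {P : Measure Ω} (hX : IsAssetVector P L X) (i : Fin n) :
    Integrable (fun ω => Real.exp |Real.log (X ω i)|) P := by
  have hm : Measurable fun ω => X ω i := hX.measurable.eval
  refine ((hX.integrable i).add (hX.integrable_inv i)).mono'
    (Real.measurable_exp.comp (Real.measurable_log.comp hm).abs).aestronglyMeasurable ?_
  filter_upwards [hX.pos i] with ω hω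
  rw [Real.norm_of_nonneg (Real.exp_pos _).le]
  have h1 : 0 < (X ω i)⁻¹ := inv_pos.2 hω
  rcases abs_cases (Real.log (X ω i)) with ⟨h, _⟩ | ⟨h, _⟩
  · rw [h, Real.exp_log hω]; simp only [Pi.add_apply]; linarith
  · rw [h, Real.exp_neg, Real.exp_log hω]; simp only [Pi.add_apply]; linarith

lemma IsAssetVector.memLp_log {P : Measure Ω} (hX : IsAssetVector P L X) (i : Fin n) :
    MemLp (fun ω => Real.log (X ω i)) 2 P := by
  have hm : Measurable fun ω => Real.log (X ω i) := Real.measurable_log.comp hX.measurable.eval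
  rw [memLp_two_iff_integrable_sq hm.aestronglyMeasurable]
  refine ((hX.integrable_exp_abs_log i).const_mul 2).mono' (hm.pow_const 2).aestronglyMeasurable
    (Eventually.of_forall fun ω => ?_)
  have := Real.quadratic_le_exp_of_nonneg (abs_nonneg (Real.log (X ω i)))
  rw [Real.norm_of_nonneg (sq_nonneg _), ← sq_abs]
  linarith [abs_nonneg (Real.log (X ω i))]

/-- Combines `|exp x - 1| ≤ |x| exp |x|` with `|y| ≤ s⁻¹ exp (s |y|)`, so that `σ` factors out of a
bound uniform in `σ ≤ s`. -/
lemma abs_exp_mul_sub_one_le {s σ : ℝ} (hs : 0 < s) (hσ : 0 ≤ σ) (hσs : σ ≤ s) (y : ℝ) :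
    |Real.exp (σ * y) - 1| ≤ σ * (s⁻¹ * Real.exp (2 * s * |y|)) := by
  have hy := abs_nonneg y
  have h1 : |Real.exp (σ * y) - 1| ≤ σ * |y| * Real.exp (σ * |y|) := by
    rw [abs_le]
    have e1 := Real.add_one_le_exp (σ * y)
    have e2 := Real.add_one_le_exp (-(σ * |y|))
    have e3 : Real.exp (σ * y) ≤ Real.exp (σ * |y|) :=
      Real.exp_le_exp.2 (by gcongr; exact le_abs_self y)
    have e4 : 1 ≤ Real.exp (σ * |y|) := Real.one_le_exp (by positivity)
    have e5 : Real.exp (-(σ * |y|)) * Real.exp (σ * |y|) = 1 := by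
      rw [← Real.exp_add]; simp
    have e6 : 0 ≤ σ * |y| := by positivity
    have e7 : -(σ * |y|) ≤ σ * y := by nlinarith [neg_abs_le y]
    constructor
    · nlinarith
    · nlinarith
  calc |Real.exp (σ * y) - 1| ≤ σ * |y| * Real.exp (σ * |y|) := h1
    _ ≤ σ * (s⁻¹ * Real.exp (s * |y|)) * Real.exp (s * |y|) := by
        gcongr
        rw [inv_mul_eq_div, le_div_iff₀ hs]
        linarith [Real.add_one_le_exp (s * |y|)]
    _ = σ * (s⁻¹ * (Real.exp (s * |y|) * Real.exp (s * |y|))) := by ring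
    _ = _ := by rw [← Real.exp_add]; ring_nf

lemma IsAssetVector.isLittleO_ES_logScaling (h : HasTameDensity P L f) {α : ℝ}
    (hα : α ∈ Set.Ioo (0 : ℝ) 1) (hX : IsAssetVector P L X) (hvol : 0 < logVol P X)
    (φ : Fin n → ℝ) :
    (fun σ : ℝ => ES P α (surplus (logScaling P X σ) L φ)
      - esExpansion P α L (logScaling P X σ) φ) =o[𝓝[>] 0] fun σ => σ ^ 2 := by
  set v := logVol P X with hv
  -- Squaring `exp (2 s |Y|)` then gives `exp (v |Y|)`, which is at most a constant times the
  -- integrable `exp |log X|`.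
  set s := v / 4 with hs
  have hs0 : 0 < s := by positivity
  set Y := normalizedLog P X with hY
  set c : Fin n → ℝ := fun i => ∫ ω, Real.log (X ω i) ∂P with hc
  have hYeq : ∀ i ω, Y i ω = (Real.log (X ω i) - c i) / v := fun i ω => rfl
  have hlog : ∀ i, Measurable fun ω => Real.log (X ω i) := fun i =>
    Real.measurable_log.comp hX.measurable.eval
  have hYm : ∀ i, Measurable (Y i) := fun i => ((hlog i).sub_const (c i)).div_const v
  have hlogi : ∀ i, Integrable (fun ω => Real.log (X ω i)) P := fun i =>
    (hX.memLp_log i).integrable (by norm_num)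
  have hYi : ∀ i, Integrable (Y i) P := fun i =>
    ((hlogi i).sub (integrable_const (c i))).div_const v
  have hY0 : ∀ i, ∫ ω, Y i ω ∂P = 0 := fun i => by
    simp only [hYeq]
    rw [integral_div, integral_sub (hlogi i) (integrable_const _)]
    simp [hc]
  set H : Fin n → Ω → ℝ := fun i ω => s⁻¹ * Real.exp (2 * s * |Y i ω|) with hH
  have hHm : ∀ i, Measurable (H i) := fun i =>
    (Real.measurable_exp.comp ((hYm i).abs.const_mul (2 * s))).const_mul s⁻¹
  have hH2 : ∀ i, MemLp (H i) 2 P := fun i => by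
    rw [memLp_two_iff_integrable_sq (hHm i).aestronglyMeasurable]
    refine ((hX.integrable_exp_abs_log i).const_mul (s⁻¹ ^ 2 * Real.exp |c i|)).mono'
      ((hHm i).pow_const 2).aestronglyMeasurable (Eventually.of_forall fun ω => ?_)
    rw [Real.norm_of_nonneg (sq_nonneg _)]
    have h1 : v * |Y i ω| ≤ |c i| + |Real.log (X ω i)| := by
      rw [hYeq, abs_div, abs_of_pos hvol, mul_div_cancel₀ _ hvol.ne', add_comm]
      exact abs_sub _ _
    calc (H i ω) ^ 2 = s⁻¹ ^ 2 * Real.exp (v * |Y i ω|) := by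
          simp only [hH]
          rw [mul_pow, ← Real.exp_nat_mul]
          congr 2
          rw [hs]; push_cast; ring
      _ ≤ s⁻¹ ^ 2 * Real.exp (|c i| + |Real.log (X ω i)|) := by gcongr
      _ = _ := by rw [Real.exp_add, mul_assoc]
  have hHi : ∀ i, Integrable (H i) P := fun i => (hH2 i).integrable (by norm_num)
  have hH0 : ∀ i ω, 0 ≤ H i ω := fun i ω => by simp only [hH]; positivity
  set G : Ω → ℝ := fun ω => ∑ i, (H i ω + ∫ ω', H i ω' ∂P) with hG
  have hG2 : MemLp G 2 P := memLp_finsetSum _ fun i _ => (hH2 i).add (memLp_const _)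
  have hev : ∀ᶠ σ : ℝ in 𝓝[>] 0, 0 < σ ∧ σ ≤ s := by
    filter_upwards [Ioc_mem_nhdsGT hs0] with σ hσ using hσ
  have hexp : ∀ σ : ℝ, 0 < σ → σ ≤ s → ∀ i, Integrable (fun ω => Real.exp (σ * Y i ω)) P :=
    fun σ hσ hσs i => by
      have h1 : Integrable (fun ω => Real.exp (σ * Y i ω) - 1) P :=
        ((hHi i).const_mul σ).mono'
          ((Real.measurable_exp.comp ((hYm i).const_mul σ)).sub_const 1).aestronglyMeasurable
          (Eventually.of_forall fun ω => abs_exp_mul_sub_one_le hs0 hσ.le hσs _)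
      exact (h1.add (integrable_const (1 : ℝ))).congr (Eventually.of_forall fun ω => by simp)
  -- From `exp x ≥ 1 + x` and `E[Y] = 0`; dividing by the normalisation therefore cannot enlarge the
  -- fluctuation.
  have hmgf1 : ∀ σ : ℝ, 0 < σ → σ ≤ s → ∀ i, 1 ≤ mgf (Y i) P σ := fun σ hσ hσs i => by
    have h1 := integral_mono (((hYi i).const_mul σ).add (integrable_const (1 : ℝ)))
      (hexp σ hσ hσs i) fun ω => Real.add_one_le_exp (σ * Y i ω)
    have h2 := integral_add ((hYi i).const_mul σ) (integrable_const (μ := P) (1 : ℝ))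
    rw [integral_const_mul, hY0] at h2
    simp only [mul_zero, integral_const, probReal_univ, one_smul, zero_add] at h2
    exact h2.symm.le.trans h1
  have hmgf2 : ∀ σ : ℝ, 0 < σ → σ ≤ s → ∀ i, mgf (Y i) P σ - 1 ≤ σ * ∫ ω, H i ω ∂P :=
    fun σ hσ hσs i => by
      have h1 : mgf (Y i) P σ - 1 = ∫ ω, (Real.exp (σ * Y i ω) - 1) ∂P := by
        rw [integral_sub (hexp σ hσ hσs i) (integrable_const _)]; simp [mgf]
      rw [h1, ← integral_const_mul]
      exact integral_mono ((hexp σ hσ hσs i).sub (integrable_const _)) ((hHi i).const_mul σ)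
        fun ω => (le_abs_self _).trans (abs_exp_mul_sub_one_le hs0 hσ.le hσs _)
  have hbound : ∀ σ : ℝ, 0 < σ → σ ≤ s → ∀ ω, ‖logScaling P X σ ω - 1‖ ≤ |σ| * G ω :=
    fun σ hσ hσs ω => by
      have hI : ∀ i, 0 ≤ ∫ ω', H i ω' ∂P := fun i => integral_nonneg (hH0 i)
      rw [abs_of_pos hσ]
      refine (pi_norm_le_iff_of_nonneg (mul_nonneg hσ.le
        (Finset.sum_nonneg fun i _ => add_nonneg (hH0 i ω) (hI i)))).2 fun i => ?_
      have hm1 := hmgf1 σ hσ hσs i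
      have hm2 := hmgf2 σ hσ hσs i
      have hmpos : 0 < mgf (Y i) P σ := by linarith
      have he := abs_exp_mul_sub_one_le hs0 hσ.le hσs (Y i ω)
      have heq : (logScaling P X σ ω - 1) i
          = ((Real.exp (σ * Y i ω) - 1) - (mgf (Y i) P σ - 1)) / mgf (Y i) P σ := by
        simp only [logScaling, Pi.sub_apply, Pi.one_apply, ← hY]
        field_simp
        ring
      have hle : H i ω + ∫ ω', H i ω' ∂P ≤ G ω :=
        Finset.single_le_sum (f := fun i => H i ω + ∫ ω', H i ω' ∂P)
          (fun j _ => add_nonneg (hH0 j ω) (hI j)) (Finset.mem_univ i)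
      rw [heq, Real.norm_eq_abs, abs_div, abs_of_pos hmpos]
      calc _ ≤ |(Real.exp (σ * Y i ω) - 1) - (mgf (Y i) P σ - 1)| :=
            div_le_self (abs_nonneg _) hm1
        _ ≤ |Real.exp (σ * Y i ω) - 1| + |mgf (Y i) P σ - 1| := abs_sub _ _
        _ ≤ σ * H i ω + σ * ∫ ω', H i ω' ∂P := by
            rw [abs_of_nonneg (show 0 ≤ mgf (Y i) P σ - 1 by linarith)]
            exact add_le_add he hm2
        _ = σ * (H i ω + ∫ ω', H i ω' ∂P) := by ring
        _ ≤ σ * G ω := by gcongr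
  refine isLittleO_ES_of_dominated h hα ?_
    (tendsto_nhdsWithin_of_tendsto_nhds tendsto_id) hG2
    (hev.mono fun σ hσ => hbound σ hσ.1 hσ.2) φ
  filter_upwards [hev] with σ ⟨hσ, hσs⟩
  set T : (Fin n → ℝ) → Fin n → ℝ := fun x i =>
    Real.exp (σ * ((Real.log (x i) - c i) / v)) / mgf (Y i) P σ with hT
  have heq : logScaling P X σ = T ∘ X := rfl
  have hTm : Measurable T := measurable_pi_lambda _ fun i =>
    (Real.measurable_exp.comp ((((Real.measurable_log.comp (measurable_pi_apply i)).sub_const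
      (c i)).div_const v).const_mul σ)).div_const _
  have hmeas : Measurable (logScaling P X σ) := by rw [heq]; exact hTm.comp hX.measurable
  refine ⟨hmeas, ?_, ?_, fun i => ?_⟩
  · rw [heq]; exact hX.indep.comp hTm measurable_id
  · have h1 : MemLp (fun ω => logScaling P X σ ω - 1) 2 P :=
      (hG2.const_mul |σ|).of_le (hmeas.sub_const 1).aestronglyMeasurable
        (Eventually.of_forall fun ω => (hbound σ hσ hσs ω).trans (le_abs_self _))
    have h2 := h1.add (memLp_const (1 : Fin n → ℝ))
    refine (memLp_congr_ae (Eventually.of_forall fun ω => ?_)).1 h2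
    simp
  · have hm1 := hmgf1 σ hσ hσs i
    simp only [logScaling]
    rw [integral_div]
    exact div_self (zero_lt_one.trans_le hm1).ne'

end LogScaling

/-! ### Uniformly square integrable families. -/

section UniformlySquareIntegrable

variable {Ω : Type*} [MeasurableSpace Ω] {P : Measure Ω} [IsProbabilityMeasure P] {n : ℕ}
  {L : Ω → Fin n → ℝ} {f : (Fin n → ℝ) → ℝ}

lemma variance_eq_zero_of_iSup_sqrt_eq_zero {P : Measure Ω} {Y : Fin n → Ω → ℝ}
    (h0 : ⨆ i, √(variance (Y i) P) = 0) (i : Fin n) : variance (Y i) P = 0 := by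
  have h1 : √(variance (Y i) P) ≤ 0 := h0 ▸ le_ciSup
    (f := fun i => √(variance (Y i) P)) (Set.finite_range _).bddAbove i
  exact le_antisymm (Real.sqrt_eq_zero'.1 (le_antisymm h1 (Real.sqrt_nonneg _)))
    (variance_nonneg _ _)

/-- Covers indices with `σ t = 0`: there `(σ t)⁻¹ = 0` by convention, so the hypothesis on the
normalised family carries no information. -/
lemma IsAssetVector.ae_eq_one_of_vol_eq_zero {X : Ω → Fin n → ℝ} (hX : IsAssetVector P L X)
    (h2 : MemLp X 2 P) (h0 : normalVol P X = 0 ∨ logVol P X = 0) : ∀ᵐ ω ∂P, X ω = 1 := by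
  suffices h : ∀ i, ∀ᵐ ω ∂P, X ω i = 1 by
    filter_upwards [ae_all_iff.2 h] with ω hω using funext hω
  intro i
  rcases h0 with h0 | h0
  · have hv := variance_eq_zero_of_iSup_sqrt_eq_zero (Y := fun i ω => X ω i) h0 i
    filter_upwards [ae_eq_integral_of_variance_eq_zero (memLp_pi_iff.1 h2 i) hv] with ω hω
    rw [hω, hX.mean_one]
  · have hv := variance_eq_zero_of_iSup_sqrt_eq_zero (Y := fun i ω => Real.log (X ω i)) h0 i
    have hconst : ∀ᵐ ω ∂P, X ω i = Real.exp (∫ ω, Real.log (X ω i) ∂P) := by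
      filter_upwards [ae_eq_integral_of_variance_eq_zero (hX.memLp_log i) hv, hX.pos i]
        with ω hω hpos
      rw [← hω, Real.exp_log hpos]
    have hmean := integral_congr_ae hconst
    rw [hX.mean_one] at hmean
    filter_upwards [hconst] with ω hω
    rw [hω]
    simpa using hmean.symm

lemma integral_norm_sq_le_of_eLpNorm_le {P : Measure Ω} {v : Ω → Fin n → ℝ} {C : ℝ} (hC : 0 ≤ C)
    (hv : AEStronglyMeasurable v P) (hle : eLpNorm v 2 P ≤ ENNReal.ofReal C) :
    ∫ ω, ‖v ω‖ ^ 2 ∂P ≤ C ^ 2 := by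
  have hmem : MemLp v 2 P := ⟨hv, hle.trans_lt ENNReal.ofReal_lt_top⟩
  rw [hmem.eLpNorm_eq_integral_rpow_norm (by norm_num) (by norm_num)] at hle
  have h1 := (ENNReal.ofReal_le_ofReal_iff hC).1 hle
  simp only [ENNReal.toReal_ofNat, Real.rpow_ofNat] at h1
  have h0 : 0 ≤ ∫ ω, ‖v ω‖ ^ 2 ∂P := integral_nonneg fun ω => sq_nonneg _
  rw [show ((2 : ℝ)⁻¹) = 1 / 2 by norm_num, ← Real.sqrt_eq_rpow] at h1
  exact (Real.sqrt_le_left hC).1 h1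

lemma isLittleO_ES_of_uniformIntegrable (h : HasTameDensity P L f) {α : ℝ}
    (hα : α ∈ Set.Ioo (0 : ℝ) 1) {ι : Type*} {l : Filter ι} {X : ι → Ω → Fin n → ℝ} {σ : ι → ℝ}
    (hX : ∀ t, IsUnitMeanL2 P L (X t)) (hσ : Tendsto σ l (𝓝 0))
    (h0 : ∀ t, σ t = 0 → ∀ᵐ ω ∂P, X t ω = 1)
    (hU : UniformIntegrable (fun t ω => (σ t)⁻¹ • (X t ω - 1)) 2 P) (φ : Fin n → ℝ) :
    (fun t => ES P α (surplus (X t) L φ) - esExpansion P α L (X t) φ) =o[l] fun t => σ t ^ 2 := by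
  obtain ⟨hUm, hUI, C, hUC⟩ := hU
  set v : ι → Ω → Fin n → ℝ := fun t ω => (σ t)⁻¹ • (X t ω - 1) with hv
  have hsq : ∀ t, ∀ᵐ ω ∂P, ‖X t ω - 1‖ ^ 2 = σ t ^ 2 * ‖v t ω‖ ^ 2 := fun t => by
    by_cases hσt : σ t = 0
    · filter_upwards [h0 t hσt] with ω hω
      rw [hω, hσt]; simp
    · refine Eventually.of_forall fun ω => ?_
      rw [← sq_abs (σ t), ← mul_pow, ← Real.norm_eq_abs, ← norm_smul, smul_inv_smul₀ hσt]
  have hE : ∀ t, ∫ ω, ‖X t ω - 1‖ ^ 2 ∂P ≤ (C : ℝ) ^ 2 * σ t ^ 2 := fun t => by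
    rw [integral_congr_ae (hsq t), integral_const_mul, mul_comm]
    gcongr
    exact integral_norm_sq_le_of_eLpNorm_le C.2 (hUm t) (by simpa using hUC t)
  refine isLittleO_ES_sub_esExpansion h hα (Eventually.of_forall hX) hσ
    (Eventually.of_forall hE) (fun η hη => ?_) φ
  rw [isLittleO_iff]
  intro ε hε
  -- The `L²` norm is the root of the mean square, hence `√ε`.
  obtain ⟨δ, hδ, hδs⟩ := hUI (Real.sqrt_pos.2 hε)
  have hlim : Tendsto (fun t => (C : ℝ) ^ 2 * σ t ^ 2) l (𝓝 0) := by
    simpa using (hσ.pow 2).const_mul ((C : ℝ) ^ 2)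
  filter_upwards [hlim.eventually (gt_mem_nhds (show 0 < η ^ 2 * δ by positivity))] with t ht
  set s := {ω | η < ‖X t ω - 1‖} with hs
  have hms : MeasurableSet s := measurableSet_lt_norm_sub_one (hX t).measurable η
  -- Chebyshev: the probability is at most `C² σ² / η²`, which is eventually below `δ`.
  have hPs : P s ≤ ENNReal.ofReal δ := by
    have h1 := mul_meas_ge_le_integral_of_nonneg (μ := P) (f := fun ω => ‖X t ω - 1‖ ^ 2)
      (Eventually.of_forall fun ω => sq_nonneg _) (hX t).integrable_norm_sq (η ^ 2)
    have h2 : P.real s ≤ P.real {ω | η ^ 2 ≤ ‖X t ω - 1‖ ^ 2} :=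
      measureReal_mono fun ω hω => pow_le_pow_left₀ hη.le (le_of_lt hω) 2
    have h3 : P.real s ≤ δ := by
      have h4 : η ^ 2 * P.real s ≤ η ^ 2 * δ :=
        (mul_le_mul_of_nonneg_left h2 (sq_nonneg η)).trans (h1.trans ((hE t).trans ht.le))
      exact le_of_mul_le_mul_left h4 (by positivity)
    rw [← ofReal_measureReal]
    exact ENNReal.ofReal_le_ofReal h3
  have hb := integral_norm_sq_le_of_eLpNorm_le (Real.sqrt_nonneg ε) ((hUm t).indicator hms)
    (hδs t s hms hPs)
  rw [Real.sq_sqrt hε.le] at hb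
  have htail : tailSq P (X t) η = σ t ^ 2 * ∫ ω, ‖s.indicator (v t) ω‖ ^ 2 ∂P := by
    rw [tailSq, ← integral_const_mul]
    refine integral_congr_ae ?_
    filter_upwards [hsq t] with ω hω
    by_cases hωs : ω ∈ s
    · rw [Set.indicator_of_mem (by exact hωs), Set.indicator_of_mem hωs, hω]
    · rw [Set.indicator_of_notMem (by exact hωs), Set.indicator_of_notMem hωs]; simp
  rw [htail, Real.norm_of_nonneg (mul_nonneg (sq_nonneg _)
    (integral_nonneg fun ω => sq_nonneg _)), Real.norm_of_nonneg (sq_nonneg _), mul_comm]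
  gcongr

end UniformlySquareIntegrable

/-! ### Minimisation of the expansion. -/

section Minimiser

variable {Ω : Type*} [MeasurableSpace Ω] {P : Measure Ω} [IsProbabilityMeasure P] {n : ℕ}
  {L X : Ω → Fin n → ℝ} {f : (Fin n → ℝ) → ℝ}

lemma IsUnitMeanL2.posDef_covMatrix (hX : IsUnitMeanL2 P L X) (hu : IsUnit (covMatrix P X)) :
    (covMatrix P X).PosDef := by
  refine (Matrix.PosSemidef.posDef_iff_isUnit
    (Matrix.PosSemidef.of_dotProduct_mulVec_nonneg ?_ fun x => ?_)).2 hu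
  · rw [Matrix.IsHermitian, Matrix.conjTranspose_eq_transpose_of_trivial]
    exact covMatrix_isSymm P X
  · rw [star_trivial, ← (hX.integral_sq_dotProduct x).2]
    exact integral_nonneg fun ω => sq_nonneg _

/-- With `K'(q) = -f(q) φ₀`, completing the square shows that the two values differ by `f(q) / (2α)`
times `⟨φ - φ₀, Σ (φ - φ₀)⟩`, positive since an invertible covariance matrix is positive definite.
-/
lemma esExpansion_minimiser_lt (h : HasTameDensity P L f) {α : ℝ} (hα : 0 < α)
    (hX : IsUnitMeanL2 P L X) (hu : IsUnit (covMatrix P X)) {φ : Fin n → ℝ}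
    (hφ : φ ≠ -((aggDensity P L (aggQuantile P L α))⁻¹ •
      deriv (KVec P L) (aggQuantile P L α))) :
    esExpansion P α L X (-((aggDensity P L (aggQuantile P L α))⁻¹ •
      deriv (KVec P L) (aggQuantile P L α))) < esExpansion P α L X φ := by
  rw [h.esExpansion_eq, h.esExpansion_eq]
  set q := aggQuantile P L α
  set d := aggDensity P L q with hd
  have hd0 : 0 < d := by rw [hd, h.aggDensity_eq]; exact h.tame.fiberIntegral_one_pos h.n_pos q
  set φ₀ := -(d⁻¹ • deriv (KVec P L) q) with hφ₀
  have hK : deriv (KVec P L) q = -(d • φ₀) := by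
    rw [hφ₀, smul_neg, neg_neg, smul_inv_smul₀ hd0.ne']
  set S := covMatrix P X with hS
  have hpos := (hX.posDef_covMatrix hu).dotProduct_mulVec_pos (sub_ne_zero.2 hφ)
  have hsymm : φ ⬝ᵥ S *ᵥ φ₀ = φ₀ ⬝ᵥ S *ᵥ φ := by
    rw [Matrix.dotProduct_mulVec, ← Matrix.mulVec_transpose, (covMatrix_isSymm P X).eq,
      dotProduct_comm]
  rw [star_trivial, Matrix.mulVec_sub, sub_dotProduct, dotProduct_sub, dotProduct_sub, hsymm]
    at hpos
  rw [hK, dotProduct_neg, dotProduct_neg, dotProduct_smul, dotProduct_smul, smul_eq_mul,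
    smul_eq_mul, dotProduct_comm (S *ᵥ φ₀), dotProduct_comm (S *ᵥ φ)]
  have hα2 : 0 < 1 / (2 * α) := by positivity
  have := mul_pos hd0 hpos
  gcongr ?_ + _ * ?_
  linarith

end Minimiser

theorem mainTheorem5 {Ω : Type*} [MeasurableSpace Ω] (P : Measure Ω) [IsProbabilityMeasure P]
    (n : ℕ) (hn : 0 < n)
    -- the claim sizes: centred, with a bounded, strictly positive, continuous density
    (L : Ω → Fin n → ℝ) (hL : Measurable L)
    (hL_mean : ∀ i, ∫ ω, L ω i ∂P = 0)
    (fL : (Fin n → ℝ) → ℝ)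
    (hfL : P.map L = volume.withDensity fun l => ENNReal.ofReal (fL l))
    (hfL_pos : ∀ l, 0 < fL l) (hfL_bdd : ∃ C, ∀ l, fL l ≤ C) (hfL_cont : Continuous fL)
    -- the suprema of the density over short segments in direction `1` have a finite second moment
    (hfL_dom : ∃ δ > 0, ∃ g : (Fin n → ℝ) → ℝ, Integrable (fun l => (1 + ‖l‖ ^ 2) * g l) ∧
      ∀ (l : Fin n → ℝ) (s : ℝ), |s| ≤ δ → fL (l + s • 1) ≤ g l)
    (α : ℝ) (hα : α ∈ Set.Ioo (0 : ℝ) 1) :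
    -- the objects in the expansion are well defined
    (Continuous (aggDensity P L) ∧ (∀ y, 0 < aggDensity P L y) ∧
      P.map (fun ω => 1 ⬝ᵥ L ω) = volume.withDensity (fun y => ENNReal.ofReal (aggDensity P L y)) ∧
      aggCdf P L (aggQuantile P L α) = 1 - α ∧
      DifferentiableAt ℝ (KVec P L) (aggQuantile P L α) ∧
      ∀ X : Ω → Fin n → ℝ, IsAssetVector P L X → MemLp X 2 P →
        DifferentiableAt ℝ (KQuad P L X L) (aggQuantile P L α) ∧
        ∀ φ : Fin n → ℝ,
          DifferentiableAt ℝ (KQuad P L X fun ω => φ - L ω) (aggQuantile P L α)) ∧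
    -- a) the expansion, for every family of assets with volatility `σ t → 0` whose
    -- normalised fluctuations `(X t - 1) / σ t` are uniformly square integrable
    (∀ {ι : Type*} (l : Filter ι) (X : ι → Ω → Fin n → ℝ) (σ : ι → ℝ),
      (∀ t, IsAssetVector P L (X t)) → (∀ t, MemLp (X t) 2 P) →
      ((∀ t, σ t = normalVol P (X t)) ∨ (∀ t, σ t = logVol P (X t))) →
      Tendsto σ l (𝓝 0) →
      UniformIntegrable (fun t ω => (σ t)⁻¹ • (X t ω - 1)) 2 P →
      ∀ φ : Fin n → ℝ,
        (fun t => ES P α (surplus (X t) L φ) - esExpansion P α L (X t) φ)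
          =o[l] fun t => σ t ^ 2) ∧
    -- in particular for the rescalings of a given asset vector to normal volatility `σ`
    (∀ X : Ω → Fin n → ℝ, IsAssetVector P L X → MemLp X 2 P → 0 < normalVol P X →
      ∀ φ : Fin n → ℝ,
        (fun σ : ℝ => ES P α (surplus (normalScaling P X σ) L φ)
            - esExpansion P α L (normalScaling P X σ) φ)
          =o[𝓝[>] 0] fun σ => σ ^ 2) ∧
    -- and for its rescalings to log-normal volatility `σ`
    (∀ X : Ω → Fin n → ℝ, IsAssetVector P L X → 0 < logVol P X →
      ∀ φ : Fin n → ℝ,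
        (fun σ : ℝ => ES P α (surplus (logScaling P X σ) L φ)
            - esExpansion P α L (logScaling P X σ) φ)
          =o[𝓝[>] 0] fun σ => σ ^ 2) ∧
    -- the explicit form of the expansion
    (∀ X : Ω → Fin n → ℝ, IsAssetVector P L X → MemLp X 2 P → ∀ φ : Fin n → ℝ,
      esExpansion P α L X φ = ES P α (fun ω => -(1 ⬝ᵥ L ω)) + 1 / (2 * α) *
        ((φ ⬝ᵥ covMatrix P X *ᵥ φ) * aggDensity P L (aggQuantile P L α)
          + 2 * ((covMatrix P X *ᵥ φ) ⬝ᵥ deriv (KVec P L) (aggQuantile P L α))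
          - deriv (KQuad P L X L) (aggQuantile P L α))) ∧
    -- b) the minimiser of the expansion
    (∀ X : Ω → Fin n → ℝ, IsAssetVector P L X → MemLp X 2 P → IsUnit (covMatrix P X) →
      ∀ φ : Fin n → ℝ,
        φ ≠ -((aggDensity P L (aggQuantile P L α))⁻¹ • deriv (KVec P L) (aggQuantile P L α)) →
        esExpansion P α L X
            (-((aggDensity P L (aggQuantile P L α))⁻¹ • deriv (KVec P L) (aggQuantile P L α)))
          < esExpansion P α L X φ) := by
  have h : HasTameDensity P L fL := ⟨hn, hL, hfL, hfL_cont, hfL_pos, hfL_dom⟩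
  refine ⟨⟨?_, ?_, h.map_total_eq, h.aggCdf_aggQuantile hα,
    (h.hasDerivAt_KVec _).differentiableAt, fun X _ _ =>
      ⟨(h.hasDerivAt_KQuad X _).differentiableAt,
        fun φ => (h.hasDerivAt_KQuad_sub X φ _).differentiableAt⟩⟩,
    ?_, ?_, ?_, fun X _ _ φ => h.esExpansion_eq α X φ, ?_⟩
  · rw [h.aggDensity_eq]
    exact h.tame.continuous_fiberIntegral hn quadGrowth_one
  · rw [h.aggDensity_eq]
    exact h.tame.fiberIntegral_one_pos hn
  · intro ι l X σ hX hX2 hvol hσ hU φ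
    refine isLittleO_ES_of_uniformIntegrable h hα (fun t => (hX t).isUnitMeanL2 (hX2 t)) hσ
      (fun t ht => (hX t).ae_eq_one_of_vol_eq_zero (hX2 t) ?_) hU φ
    exact hvol.imp (fun hv => (hv t).symm.trans ht) fun hv => (hv t).symm.trans ht
  · intro X hX hX2 _ φ
    exact isLittleO_ES_normalScaling h hα (hX.isUnitMeanL2 hX2) φ
  · intro X hX hvol φ
    exact hX.isLittleO_ES_logScaling h hα hvol φ
  · intro X hX hX2 hu φ hφ
    exact esExpansion_minimiser_lt h hα.1 (hX.isUnitMeanL2 hX2) hu hφ
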